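/- Let $n\ge 0$ and let $\gamma\in PSL(n+1,\mathbb C)$ be an element of infinite order, acting on complex projective space $\mathbb P^n$ (with its Fubini–Study distance). Let $\widetilde\gamma\in SL(n+1,\mathbb C)$ be a lift of $\gamma$ and let $(k,\{V_j\}_{j=1}^k,\{\gamma_j\}_{j=1}^k,\{r_j\}_{j=1}^k)$ be a unitary decomposition of $\widetilde\gamma$: the $V_j$ are nonzero linear subspaces with $\bigoplus_{j=1}^k V_j=\mathbb C^{n+1}$; the $\gamma_j:V_j\to V_j$ are linear maps all of whose eigenvalues have modulus $1$; $0<r_1<\dots<r_k$ are real; and $\widetilde\gamma=\bigoplus_{j=1}^k r_j\gamma_j$. A block decomposition of a linear map $T:V\to V$ of a finite-dimensional complex vector space consists of a direct sum decomposition $V=\bigoplus_{i=1}^s U_i$, a basis $\beta_i$ of $U_i$, numbers $\lambda_i$ of modulus $1$ (not necessarily distinct) and linear maps $T_i:U_i\to U_i$ such that $T=\bigoplus_i\lambda_iT_i$, the characteristic polynomial of $T_i$ is $(x-1)^{\dim U_i}$, and each $T_i$ either is the identity or has a Jordan block as its matrix in the basis $\beta_i$. Put $H(T)=\max(\{\dim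 U_i : T_i\neq \mathrm{id}\}\cup\{0\})$; put $\Xi(T)=\emptyset$ if $H(T)<2$, and otherwise $$\Xi(T)=\Big\langle \bigcup_{i}\beta_i\setminus\bigcup_i\{w\in\beta_i : \dim U_i=H(T)=\dim\langle\{T_i^m(w)\}_{m\in\mathbb Z}\rangle\}\Big\rangle .$$ The equicontinuity region $Eq(\langle\gamma\rangle)$ is the set of points of $\mathbb P^n$ that have an open neighbourhood $U$ on which the cyclic group $\langle\gamma\rangle$ is a normal family, i.e. every sequence in $\langle\gamma\rangle$ has a subsequence that converges uniformly on compact subsets of $U$. Then block decompositions of $\gamma_1$ and $\gamma_k$ exist, and, whichever block decompositions are used to form $\Xi(\gamma_1)$ and $\Xi(\gamma_k)$, $$\mathbb P^n\setminus Eq(\langle\gamma\rangle)=\Big[\Big\langle\bigcup_{j>1}V_j\cup\Xi(\gamma_1)\Big\rangle\setminus\{0\}\Big]\cup\Big[\Big\langle\bigcup_{j<k}V_j\cup\Xi(\gamma_k)\Big\rangle\setminus\{0\}\Big],$$ where $\langle\cdot\rangle$ denotes the linear span and $[\cdot]$ the image in $\mathbb P^n$. -/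

import Mathlib

open scoped LinearAlgebra.Projectivization

noncomputable section

namespace ProjDyn

/-- Complex projective space `ℙⁿ`, the set of lines of `ℂⁿ⁺¹`. -/
abbrev PSpace (n : ℕ) : Type := ℙ ℂ (Fin (n + 1) → ℂ)

/-- The quotient topology coming from `ℂⁿ⁺¹ ∖ {0}`. -/
instance instTopologicalSpacePSpace (n : ℕ) : TopologicalSpace (PSpace n) :=
  TopologicalSpace.coinduced
    (fun v : {v : Fin (n + 1) → ℂ // v ≠ 0} => Projectivization.mk ℂ v.1 v.2) inferInstance

/-- The angle between the complex lines of `v` and `w`,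
`arccos (|⟨v, w⟩| / (‖v‖ ‖w‖))`, for the standard Hermitian product of `ℂⁿ⁺¹`. -/
def lineAngle {n : ℕ} (v w : Fin (n + 1) → ℂ) : ℝ :=
  Real.arccos (‖inner ℂ (WithLp.toLp 2 v) (WithLp.toLp 2 w)‖ /
    (‖WithLp.toLp 2 v‖ * ‖WithLp.toLp 2 w‖))

/-- The Fubini–Study distance on `ℙⁿ`. -/
def fsDist {n : ℕ} (p q : PSpace n) : ℝ := lineAngle p.rep q.rep

lemma lineAngle_smul {n : ℕ} (a b : ℂ) (ha : a ≠ 0) (hb : b ≠ 0) (v w : Fin (n + 1) → ℂ) :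
    lineAngle (a • v) (b • w) = lineAngle v w := by
  have ha' : ‖a‖ ≠ 0 := norm_ne_zero_iff.mpr ha
  have hb' : ‖b‖ ≠ 0 := norm_ne_zero_iff.mpr hb
  unfold lineAngle
  rw [WithLp.toLp_smul, WithLp.toLp_smul, inner_smul_left, inner_smul_right]
  simp only [norm_mul, norm_smul, RCLike.norm_conj]
  congr 1
  rw [show ‖a‖ * (‖b‖ * ‖inner ℂ (WithLp.toLp 2 v) (WithLp.toLp 2 w)‖)
      = (‖a‖ * ‖b‖) * ‖inner ℂ (WithLp.toLp 2 v) (WithLp.toLp 2 w)‖ by ring,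
    show ‖a‖ * ‖WithLp.toLp 2 v‖ * (‖b‖ * ‖WithLp.toLp 2 w‖)
      = (‖a‖ * ‖b‖) * (‖WithLp.toLp 2 v‖ * ‖WithLp.toLp 2 w‖) by ring]
  exact mul_div_mul_left _ _ (mul_ne_zero ha' hb')

/-- The Fubini–Study distance may be computed from any representatives. -/
lemma fsDist_mk {n : ℕ} (v w : Fin (n + 1) → ℂ) (hv : v ≠ 0) (hw : w ≠ 0) :
    fsDist (Projectivization.mk ℂ v hv) (Projectivization.mk ℂ w hw) = lineAngle v w := by
  obtain ⟨a, ha⟩ := Projectivization.exists_smul_eq_mk_rep ℂ v hv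
  obtain ⟨b, hb⟩ := Projectivization.exists_smul_eq_mk_rep ℂ w hw
  unfold fsDist
  rw [← ha, ← hb]
  exact lineAngle_smul (a : ℂ) (b : ℂ) a.ne_zero b.ne_zero v w

/-- A family `F` of self-maps of `ℙⁿ` is normal on `U`: every sequence of members of `F` has a
subsequence that converges uniformly on the compact subsets of `U`. -/
def IsNormalFamilyOn {n : ℕ} (F : Set (PSpace n → PSpace n)) (U : Set (PSpace n)) : Prop :=
  ∀ f : ℕ → PSpace n → PSpace n, (∀ m, f m ∈ F) →
    ∃ φ : ℕ → ℕ, StrictMono φ ∧ ∃ f₀ : PSpace n → PSpace n,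
      ∀ K : Set (PSpace n), IsCompact K → K ⊆ U →
        ∀ ε : ℝ, 0 < ε → ∃ M : ℕ, ∀ m, M ≤ m → ∀ x ∈ K, fsDist (f (φ m) x) (f₀ x) < ε

/-- The equicontinuity region `Eq(F)`: the points with an open neighbourhood on which `F` is a
normal family. -/
def equicontinuityRegion {n : ℕ} (F : Set (PSpace n → PSpace n)) : Set (PSpace n) :=
  {z | ∃ U : Set (PSpace n), IsOpen U ∧ z ∈ U ∧ IsNormalFamilyOn F U}

/-- `PSL(n+1, ℂ)`. -/
abbrev PSL (n : ℕ) : Type := Matrix.ProjectiveSpecialLinearGroup (Fin (n + 1)) ℂ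

/-- The self-maps of `ℙⁿ` given by the elements of a subgroup of `PSL(n+1, ℂ)`. -/
def groupMaps {n : ℕ} (Γ : Subgroup (PSL n)) : Set (PSpace n → PSpace n) :=
  {f | ∃ h ∈ Γ, f = fun p => h • p}

/-- The projectivisation `[W ∖ {0}]` of a linear subspace `W` of `ℂⁿ⁺¹`. -/
def projectivize {n : ℕ} (W : Submodule ℂ (Fin (n + 1) → ℂ)) : Set (PSpace n) :=
  {p | ∃ (v : Fin (n + 1) → ℂ) (hv : v ≠ 0), v ∈ W ∧ p = Projectivization.mk ℂ v hv}

/-- A unitary decomposition of `T`: a direct sum decomposition `⨁ V_j` of the whole space into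
nonzero subspaces, with `T = ⨁ r_j γ_j`, where every eigenvalue of `γ_j : V_j → V_j` has modulus
one and `0 < r_1 < ⋯ < r_k`. -/
structure UnitaryDecomposition {E : Type*} [AddCommGroup E] [Module ℂ E] (T : E →ₗ[ℂ] E) where
  /-- the number of summands -/
  k : ℕ
  k_pos : 0 < k
  /-- the summands -/
  V : Fin k → Submodule ℂ E
  /-- the maps `γ_j` -/
  op : (j : Fin k) → V j →ₗ[ℂ] V j
  /-- the radii `r_j` -/
  r : Fin k → ℝ
  V_ne_bot : ∀ j, V j ≠ ⊥
  isInternal : DirectSum.IsInternal V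
  eigenvalue_norm : ∀ j, ∀ μ : ℂ, Module.End.HasEigenvalue (op j) μ → ‖μ‖ = 1
  r_pos : ∀ j, 0 < r j
  r_strictMono : StrictMono r
  map_eq : ∀ j, ∀ v : V j, T (v : E) = (r j : ℂ) • ((op j v : V j) : E)

/-- The index of the smallest radius. -/
def UnitaryDecomposition.first {E : Type*} [AddCommGroup E] [Module ℂ E] {T : E →ₗ[ℂ] E}
    (D : UnitaryDecomposition T) : Fin D.k := ⟨0, D.k_pos⟩

/-- The index of the largest radius. -/
def UnitaryDecomposition.last {E : Type*} [AddCommGroup E] [Module ℂ E] {T : E →ₗ[ℂ] E}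
    (D : UnitaryDecomposition T) : Fin D.k := ⟨D.k - 1, Nat.sub_lt D.k_pos one_pos⟩

/-- The `d × d` Jordan block with eigenvalue `1`. -/
def jordanBlock (d : ℕ) : Matrix (Fin d) (Fin d) ℂ :=
  Matrix.of fun a b => if a = b then 1 else if (a : ℕ) + 1 = (b : ℕ) then 1 else 0

/-- A block decomposition of `T`: a direct sum decomposition `⨁ V_j` of the whole space with
`T = ⨁ λ_j T_j`, `|λ_j| = 1`, where each `T_j : V_j → V_j` has characteristic polynomial
`(x - 1) ^ dim V_j` and either is the identity or has a Jordan block as its matrix in the basis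
`β_j` of `V_j`. -/
structure BlockDecomposition {E : Type*} [AddCommGroup E] [Module ℂ E] [FiniteDimensional ℂ E]
    (T : E →ₗ[ℂ] E) where
  /-- the number of summands -/
  k : ℕ
  /-- the summands -/
  V : Fin k → Submodule ℂ E
  /-- the bases `β_j` -/
  basis : (j : Fin k) → Module.Basis (Fin (Module.finrank ℂ (V j))) ℂ (V j)
  /-- the scalars `λ_j` -/
  scalar : Fin k → ℂ
  /-- the maps `T_j` -/
  op : (j : Fin k) → V j →ₗ[ℂ] V j
  isInternal : DirectSum.IsInternal V
  scalar_norm : ∀ j, ‖scalar j‖ = 1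
  map_eq : ∀ j, ∀ v : V j, T (v : E) = scalar j • ((op j v : V j) : E)
  charpoly_eq : ∀ j, (op j).charpoly = (Polynomial.X - 1) ^ Module.finrank ℂ (V j)
  id_or_jordan : ∀ j, op j = LinearMap.id ∨
    LinearMap.toMatrix (basis j) (basis j) (op j) = jordanBlock (Module.finrank ℂ (V j))

namespace BlockDecomposition

variable {E : Type*} [AddCommGroup E] [Module ℂ E] [FiniteDimensional ℂ E] {T : E →ₗ[ℂ] E}

open Classical in
/-- `H(T)`: the largest dimension of a block on which `T_j` is not the identity, and `0` if there
is no such block. -/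
def H (B : BlockDecomposition T) : ℕ :=
  (Finset.univ.filter fun j : Fin B.k => B.op j ≠ LinearMap.id).sup
    fun j => Module.finrank ℂ (B.V j)

/-- The orbit `{T_j ^ m w : m ∈ ℤ}`; negative powers of the bijection `T_j` are written as
preimages. -/
def orbit (B : BlockDecomposition T) (j : Fin B.k) (w : B.V j) : Set (B.V j) :=
  {u | ∃ m : ℕ, u = (B.op j ^ m) w ∨ (B.op j ^ m) u = w}

/-- The vectors `w ∈ β_j` with `dim V_j = H(T) = dim ⟨{T_j ^ m w : m ∈ ℤ}⟩`, for some `j`. -/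
def topVectors (B : BlockDecomposition T) : Set E :=
  {w | ∃ j i, w = (B.basis j i : E) ∧ Module.finrank ℂ (B.V j) = B.H ∧
    Module.finrank ℂ (Submodule.span ℂ (B.orbit j (B.basis j i))) = B.H}

open Classical in
/-- `Ξ(T)`: empty if `H(T) < 2`, and otherwise the span of all basis vectors other than those in
`topVectors`. -/
def Xi (B : BlockDecomposition T) : Set E :=
  if B.H < 2 then ∅
  else (Submodule.span ℂ ({w | ∃ j i, w = (B.basis j i : E)} \ B.topVectors) : Set E)

end BlockDecomposition

end ProjDyn

end

/-! Only the asymptotics of large powers matter. On a Jordan block with operator rλ(1+N), |λ| = 1,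
the m-th power is r^m λ^m ∑ C(m,l) N^l. For positive powers the largest radius dominates, and inside
its summand the terms with l = d := H-1 dominate. Divide by r_k^m C(m,d) and pass to a subsequence
along which the phases λ_i^m converge: the powers then converge to a nonzero operator A. It vanishes
on the other V_j and equals μ_i N_i^d, with |μ_i| = 1, on the blocks of V_k. So ker A is the same
for every subsequence (`exists_subseq_tendsto_normalized_pow`). In a Jordan basis, N_i^d kills every
basis vector except the last one of each non-identity block of dimension H, when H ≥ 2; hence ⨁ ker
N_i^d is the span of Ξ (`span_Xi`). Negative powers are handled by applying the same argument to the
inverse, whose dominant summand is V_1. `HasLimitKernel` records the outcome.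

Convergence of operators is then turned into dynamics. Away from ker A the induced projective maps
converge uniformly on compact sets (`exists_uniform_limit_of_tendsto`). Near a point [v] of ker A
they cannot (`not_uniform_limit_of_tendsto`): on a disc v + tw with Aw ≠ 0, images of points with t
≠ 0 tend to [Aw], while parameters tending to 0 have images orthogonal to Aw. Since every sequence
of integer exponents has a subsequence that is constant or tends to ±∞, the complement of the
equicontinuity region is the union of the two limit kernels. Block decompositions exist by the
Jordan normal form, obtained from the structure theorem for torsion modules over ℂ[X]. -/

noncomputable section

open Filter Topology
open scoped LinearAlgebra.Projectivization

namespace ProjDyn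

/-! ### The Fubini–Study distance and projective limits of converging operators. -/

section Geometry

variable {n : ℕ}

local notation "ℂⁿ" => Fin (n + 1) → ℂ

lemma inner_real_toLp (x y : ℂⁿ) : inner ℝ (WithLp.toLp 2 x) (WithLp.toLp 2 y) =
    (inner ℂ (WithLp.toLp 2 x) (WithLp.toLp 2 y)).re := by
  simp [PiLp.inner_apply, Complex.inner]

lemma lineAngle_le_angle (x y : ℂⁿ) :
    lineAngle x y ≤ InnerProductGeometry.angle (WithLp.toLp 2 x) (WithLp.toLp 2 y) := by
  unfold lineAngle InnerProductGeometry.angle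
  apply Real.arccos_le_arccos
  rw [inner_real_toLp]
  gcongr
  exact (Complex.re_le_norm _)

lemma lineAngle_comm (x y : ℂⁿ) : lineAngle x y = lineAngle y x := by
  unfold lineAngle
  rw [norm_inner_symm, mul_comm]

/-- Rotating the first vector by a phase turns the angle of lines into an angle of vectors. -/
lemma exists_smul_lineAngle_eq_angle (x y : ℂⁿ) : ∃ a : ℂ, a ≠ 0 ∧
    lineAngle x y =
      InnerProductGeometry.angle (WithLp.toLp 2 (a • x)) (WithLp.toLp 2 y) := by
  obtain ⟨a, ha, h⟩ : ∃ a : ℂ, ‖a‖ = 1 ∧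
      a * inner ℂ (WithLp.toLp 2 x) (WithLp.toLp 2 y) =
        (‖inner ℂ (WithLp.toLp 2 x) (WithLp.toLp 2 y)‖ : ℂ) := by
    obtain ⟨c, hc, h⟩ := RCLike.exists_norm_eq_mul_self
      (inner ℂ (WithLp.toLp 2 x) (WithLp.toLp 2 y))
    exact ⟨c, hc, h.symm⟩
  have ha0 : a ≠ 0 := by rintro rfl; simp at ha
  refine ⟨(starRingEnd ℂ) a, by simpa using ha0, ?_⟩
  unfold lineAngle InnerProductGeometry.angle
  rw [inner_real_toLp, WithLp.toLp_smul, inner_smul_left, Complex.conj_conj, h, norm_smul,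
    RCLike.norm_conj, ha, one_mul, Complex.ofReal_re]

/-- Rotating x and z by phases makes both line angles with y angles of real vectors. The triangle
inequality for those angles then applies, because a line angle never exceeds the vector angle. -/
lemma lineAngle_triangle (x y z : ℂⁿ) : lineAngle x z ≤ lineAngle x y + lineAngle y z := by
  obtain ⟨a, ha, h₁⟩ := exists_smul_lineAngle_eq_angle x y
  obtain ⟨b, hb, h₂⟩ := exists_smul_lineAngle_eq_angle z y
  rw [lineAngle_comm y z, h₁, h₂, ← lineAngle_smul a b ha hb x z,
    InnerProductGeometry.angle_comm (WithLp.toLp 2 (b • z))]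
  exact (lineAngle_le_angle _ _).trans (InnerProductGeometry.angle_le_angle_add_angle _ _ _)

lemma fsDist_triangle (p q r : PSpace n) : fsDist p r ≤ fsDist p q + fsDist q r :=
  lineAngle_triangle _ _ _

lemma fsDist_comm (p q : PSpace n) : fsDist p q = fsDist q p :=
  lineAngle_comm _ _

lemma lineAngle_self {x : ℂⁿ} (hx : x ≠ 0) : lineAngle x x = 0 := by
  have : ‖WithLp.toLp 2 x‖ ≠ 0 := by simpa using hx
  unfold lineAngle
  rw [inner_self_eq_norm_sq_to_K]
  simp [pow_two, this]

lemma fsDist_self (p : PSpace n) : fsDist p p = 0 := lineAngle_self p.rep_nonzero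

lemma continuousAt_lineAngle {x y : ℂⁿ} (hx : x ≠ 0) (hy : y ≠ 0) :
    ContinuousAt (fun x => lineAngle x y) x := by
  unfold lineAngle
  have h : Continuous fun x : ℂⁿ => WithLp.toLp 2 x := PiLp.continuous_toLp 2 _
  refine Real.continuous_arccos.continuousAt.comp (ContinuousAt.div ?_ ?_ ?_)
  · exact (h.inner continuous_const).norm.continuousAt
  · exact (h.norm.mul continuous_const).continuousAt
  · simp [hx, hy]

/-- A relative error η < 1 keeps x nonzero and, by Cauchy–Schwarz, makes the cosine of the line
angle at least (1-η)/(1+η), which tends to 1 as η → 0. -/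
lemma exists_lineAngle_lt {ε : ℝ} (hε : 0 < ε) : ∃ η > 0, ∀ x y : ℂⁿ, y ≠ 0 →
    ‖WithLp.toLp 2 x - WithLp.toLp 2 y‖ ≤ η * ‖WithLp.toLp 2 y‖ → lineAngle x y < ε := by
  have hc : ContinuousAt (fun η : ℝ => Real.arccos ((1 - η) / (1 + η))) 0 := by
    refine Real.continuous_arccos.continuousAt.comp (ContinuousAt.div ?_ ?_ ?_)
    · fun_prop
    · fun_prop
    · simp
  have h0 : ∀ᶠ η : ℝ in 𝓝 0, Real.arccos ((1 - η) / (1 + η)) < ε :=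
    hc.eventually (gt_mem_nhds (by simpa using hε))
  have h1 : ∀ᶠ η : ℝ in 𝓝 0, η < 1 := gt_mem_nhds one_pos
  have h2 : ∀ᶠ η : ℝ in 𝓝[>] 0, 0 < η := self_mem_nhdsWithin
  obtain ⟨η, ⟨h0, h1⟩, h2⟩ := ((h0.and h1).filter_mono nhdsWithin_le_nhds |>.and h2).exists
  refine ⟨η, h2, fun x y hy h => lt_of_le_of_lt (Real.arccos_le_arccos ?_) h0⟩
  set X := WithLp.toLp 2 x
  set Y := WithLp.toLp 2 y
  have hY : 0 < ‖Y‖ := by simpa [Y] using hy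
  have hXl : ‖Y‖ - η * ‖Y‖ ≤ ‖X‖ := by
    have := norm_sub_norm_le Y X
    rw [norm_sub_rev] at this
    linarith
  have hX : 0 < ‖X‖ := lt_of_lt_of_le (by nlinarith) hXl
  have hXu : ‖X‖ ≤ (1 + η) * ‖Y‖ := by
    have := norm_sub_norm_le X Y
    linarith
  have hin : (1 - η) * ‖Y‖ ^ 2 ≤ ‖inner ℂ X Y‖ := by
    have e : inner ℂ X Y = inner ℂ Y Y + inner ℂ (X - Y) Y := by
      rw [← inner_add_left]; congr 1; abel
    have h3 : ‖inner ℂ (X - Y) Y‖ ≤ η * ‖Y‖ * ‖Y‖ :=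
      (norm_inner_le_norm _ _).trans (by gcongr)
    have h4 : ‖inner ℂ Y Y‖ = ‖Y‖ ^ 2 := by
      rw [inner_self_eq_norm_sq_to_K]; simp
    have h5 := norm_sub_le (inner ℂ X Y) (inner ℂ (X - Y) Y)
    have h6 : inner ℂ X Y - inner ℂ (X - Y) Y = inner ℂ Y Y := by rw [e]; ring
    rw [h6, h4] at h5
    nlinarith
  rw [div_le_div_iff₀ (by linarith) (by positivity)]
  calc (1 - η) * (‖X‖ * ‖Y‖) ≤ (1 - η) * (((1 + η) * ‖Y‖) * ‖Y‖) := by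
        gcongr
    _ = ((1 - η) * ‖Y‖ ^ 2) * (1 + η) := by ring
    _ ≤ _ := by gcongr

lemma continuous_mk : Continuous fun v : {v : ℂⁿ // v ≠ 0} =>
    (Projectivization.mk ℂ v.1 v.2 : PSpace n) := continuous_coinduced_rng

/-- Invariance under scaling makes the condition independent of the arbitrary representative, so its
preimage under the quotient map is s without the origin. -/
lemma isOpen_setOf_rep {s : Set ℂⁿ} (hs : IsOpen s) (hc : ∀ c : ℂ, c ≠ 0 → ∀ v ∈ s, c • v ∈ s) :
    IsOpen {p : PSpace n | p.rep ∈ s} := by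
  refine isOpen_coinduced.mpr ?_
  convert! hs.preimage continuous_subtype_val using 1
  ext ⟨v, hv⟩
  obtain ⟨a, ha⟩ := Projectivization.exists_smul_eq_mk_rep ℂ v hv
  simp only [Set.mem_preimage, Set.mem_ofPred_eq]
  rw [← ha]
  refine ⟨fun h => ?_, fun h => hc _ a.ne_zero _ h⟩
  have := hc _ (inv_ne_zero a.ne_zero) _ h
  rwa [Units.smul_def, inv_smul_smul₀ a.ne_zero] at this

/-- If the operators `B m` converge to `A`, the maps they induce on `ℙⁿ` converge uniformly on
compact sets away from the kernel of `A`. -/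
theorem exists_uniform_limit_of_tendsto {B : ℕ → ℂⁿ →L[ℂ] ℂⁿ} {A : ℂⁿ →L[ℂ] ℂⁿ}
    (hB : Tendsto B atTop (𝓝 A)) {F : ℕ → PSpace n → PSpace n}
    (hF : ∀ m v (hv : v ≠ 0), ∃ h, F m (Projectivization.mk ℂ v hv) =
      Projectivization.mk ℂ (B m v) h) :
    ∃ f₀ : PSpace n → PSpace n, ∀ K : Set (PSpace n), IsCompact K → K ⊆ {p | A p.rep ≠ 0} →
      ∀ ε : ℝ, 0 < ε → ∃ M : ℕ, ∀ m, M ≤ m → ∀ x ∈ K, fsDist (F m x) (f₀ x) < ε := by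
  classical
  let L := (PiLp.continuousLinearEquiv 2 ℂ (fun _ : Fin (n + 1) => ℂ)).symm
  let L' : ℂⁿ →L[ℂ] EuclideanSpace ℂ (Fin (n + 1)) := L
  have hLap : ∀ x, WithLp.toLp 2 x = L x := fun _ => rfl
  -- The value on the kernel of A is a default: the compact sets considered avoid it.
  refine ⟨fun p => if h : A p.rep ≠ 0 then Projectivization.mk ℂ (A p.rep) h else p, ?_⟩
  intro K hK hKU ε hε
  obtain ⟨η, hη, H⟩ := exists_lineAngle_lt (n := n) hε
  -- a uniform lower bound for `A` on `K`
  obtain ⟨k, hk⟩ : ∃ k : ℕ, K ⊆ {p : PSpace n | p.rep ∈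
      {v : ℂⁿ | (1 / ((k : ℝ) + 1)) * ‖v‖ < ‖L (A v)‖}} := by
    -- These open sets grow with k and cover K, so compactness selects a single one.
    refine hK.elim_directed_cover _ (fun k => isOpen_setOf_rep ?_ ?_) ?_ ?_
    · exact isOpen_lt (by fun_prop) (by fun_prop)
    · intro c hc v hv
      simp only [Set.mem_ofPred_eq, map_smul, norm_smul] at hv ⊢
      have : 0 < ‖c‖ := norm_pos_iff.mpr hc
      nlinarith
    · intro p hp
      have h0 : 0 < ‖L (A p.rep)‖ := norm_pos_iff.mpr (by simpa using hKU hp)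
      have h1 : 0 < ‖p.rep‖ := norm_pos_iff.mpr p.rep_nonzero
      obtain ⟨k, hk⟩ := exists_nat_one_div_lt (div_pos h0 h1)
      exact Set.mem_iUnion.mpr ⟨k, (lt_div_iff₀ h1).mp hk⟩
    · refine Monotone.directed_le fun i j hij p hp => ?_
      simp only [Set.mem_ofPred_eq] at hp ⊢
      refine lt_of_le_of_lt ?_ hp
      gcongr
  have hδ : (0 : ℝ) < 1 / ((k : ℝ) + 1) := by positivity
  set δ : ℝ := 1 / ((k : ℝ) + 1)
  have hev : ∀ᶠ m in atTop, ‖L'.comp (B m - A)‖ < η * δ := by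
    have h1 : Tendsto (fun m => ‖L'.comp (B m - A)‖) atTop
        (𝓝 ‖L'.comp (A - A)‖) :=
      (((ContinuousLinearMap.compL ℂ ℂⁿ ℂⁿ (EuclideanSpace ℂ (Fin (n + 1)))
        L').continuous.tendsto _).comp (hB.sub_const A)).norm
    simp only [sub_self, ContinuousLinearMap.comp_zero, norm_zero] at h1
    exact h1.eventually (gt_mem_nhds (by positivity))
  obtain ⟨M, hM⟩ := eventually_atTop.mp hev
  refine ⟨M, fun m hm p hp => ?_⟩
  have hA : A p.rep ≠ 0 := hKU hp
  obtain ⟨h, hFm⟩ := hF m p.rep p.rep_nonzero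
  rw [Projectivization.mk_rep] at hFm
  simp only [dif_pos hA, hFm]
  rw [fsDist_mk]
  refine H _ _ hA ?_
  have e : WithLp.toLp 2 (B m p.rep) - WithLp.toLp 2 (A p.rep) =
      (L'.comp (B m - A)) p.rep := by
    simp [hLap, L']
  rw [e, hLap]
  calc _ ≤ ‖L'.comp (B m - A)‖ * ‖p.rep‖ :=
        ContinuousLinearMap.le_opNorm _ _
    _ ≤ (η * δ) * ‖p.rep‖ := by gcongr; exact (hM m hm).le
    _ = η * (δ * ‖p.rep‖) := by ring
    _ ≤ _ := by gcongr; exact (hk hp).le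

/-- If the injective operators `B m` converge to `A ≠ 0`, the maps they induce on `ℙⁿ` do not
converge uniformly on the compact subsets of any neighbourhood of a point of the kernel of `A`. -/
theorem not_uniform_limit_of_tendsto {B : ℕ → ℂⁿ →L[ℂ] ℂⁿ} {A : ℂⁿ →L[ℂ] ℂⁿ}
    (hB : Tendsto B atTop (𝓝 A)) (hA : A ≠ 0) {F : ℕ → PSpace n → PSpace n}
    (hF : ∀ m v (hv : v ≠ 0), ∃ h, F m (Projectivization.mk ℂ v hv) =
      Projectivization.mk ℂ (B m v) h)
    {v : ℂⁿ} (hv : v ≠ 0) (hAv : A v = 0) {U : Set (PSpace n)} (hU : IsOpen U)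
    (hvU : Projectivization.mk ℂ v hv ∈ U) (f₀ : PSpace n → PSpace n)
    (hf₀ : ∀ K : Set (PSpace n), IsCompact K → K ⊆ U →
      ∀ ε : ℝ, 0 < ε → ∃ M : ℕ, ∀ m, M ≤ m → ∀ x ∈ K, fsDist (F m x) (f₀ x) < ε) : False := by
  obtain ⟨w, hw⟩ : ∃ w, A w ≠ 0 := by
    by_contra! h
    exact hA (ContinuousLinearMap.ext h)
  have hBne : ∀ m x, x ≠ 0 → B m x ≠ 0 := fun m x hx => (hF m x hx).1
  have hAt : ∀ t : ℂ, A (v + t • w) = t • A w := fun t => by simp [hAv]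
  have hx : ∀ t : ℂ, v + t • w ≠ 0 := by
    intro t h
    have h1 := hAt t
    rw [h, map_zero] at h1
    have : t = 0 := by
      by_contra ht
      exact (smul_ne_zero ht hw) h1.symm
    simp [this, hv] at h
  -- the projective disc through `[v]`
  let ψ : ℂ → PSpace n := fun t => Projectivization.mk ℂ (v + t • w) (hx t)
  have hψ : Continuous ψ := continuous_mk.comp
    (f := fun t : ℂ => (⟨v + t • w, hx t⟩ : {v : ℂⁿ // v ≠ 0})) (by fun_prop)
  have hψ0 : ψ 0 ∈ U := by simpa [ψ] using hvU
  obtain ⟨δ, hδ, hball⟩ := Metric.mem_nhds_iff.mp ((hU.preimage hψ).mem_nhds hψ0)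
  let K := ψ '' Metric.closedBall 0 (δ / 2)
  have hK : IsCompact K := (isCompact_closedBall _ _).image hψ
  have hKU : K ⊆ U := by
    rintro _ ⟨t, ht, rfl⟩
    exact hball (Metric.closedBall_subset_ball (by linarith) ht)
  obtain ⟨M, hM⟩ := hf₀ K hK hKU (1 / 4) (by norm_num)
  have hFψ : ∀ m t, ∃ h, F m (ψ t) = Projectivization.mk ℂ (B m (v + t • w)) h :=
    fun m t => hF m _ _
  have happ : ∀ x, Tendsto (fun m => B m x) atTop (𝓝 (A x)) := fun x =>
    ((ContinuousLinearMap.apply ℂ ℂⁿ x).continuous.tendsto _).comp hB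
  -- Compare the m-th image of ψ t with f₀, then with a much later m'-th image, then with [A w], its
  -- limit since A (v + t • w) = t • A w. Three errors of 1/4 add up to 3/4 < π/2.
  have key : ∀ m, M ≤ m → ∀ t : ℂ, t ≠ 0 → ‖t‖ ≤ δ / 2 →
      lineAngle (B m (v + t • w)) (A w) ≤ 3 / 4 := by
    intro m hm t ht htδ
    have htA : A (v + t • w) ≠ 0 := by rw [hAt]; exact smul_ne_zero ht hw
    have h1 : Tendsto (fun m' => lineAngle (B m' (v + t • w)) (A w)) atTop (𝓝 0) := by
      have h2 := (continuousAt_lineAngle htA hw).tendsto.comp (happ (v + t • w))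
      have h3 : lineAngle (A (v + t • w)) (A w) = 0 := by
        rw [hAt, show A w = (1 : ℂ) • A w by simp, smul_smul, mul_one,
          lineAngle_smul _ _ ht one_ne_zero, lineAngle_self hw]
      rw [h3] at h2
      exact h2
    obtain ⟨m', hm'M, hm'⟩ := ((eventually_ge_atTop M).and
      (h1.eventually (gt_mem_nhds (show (0 : ℝ) < 1 / 4 by norm_num)))).exists
    have hxK : ψ t ∈ K := ⟨t, by simpa using htδ, rfl⟩
    have h4 := hM m hm _ hxK
    have h5 := hM m' hm'M _ hxK
    rw [fsDist_comm] at h5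
    have h6 := fsDist_triangle (F m (ψ t)) (f₀ (ψ t)) (F m' (ψ t))
    obtain ⟨_, e1⟩ := hFψ m t
    obtain ⟨_, e2⟩ := hFψ m' t
    have h7 : fsDist (F m (ψ t)) (F m' (ψ t)) =
        lineAngle (B m (v + t • w)) (B m' (v + t • w)) := by
      rw [e1, e2, fsDist_mk]
    have h8 := lineAngle_triangle (B m (v + t • w)) (B m' (v + t • w)) (A w)
    linarith
  -- the parameter at which the image is orthogonal to `A w`
  have hinner : ∀ x, Tendsto (fun m => inner ℂ (WithLp.toLp 2 (A w)) (WithLp.toLp 2 (B m x))) atTop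
      (𝓝 (inner ℂ (WithLp.toLp 2 (A w)) (WithLp.toLp 2 (A x)))) := by
    intro x
    have hc : Continuous fun y : ℂⁿ => inner ℂ (WithLp.toLp 2 (A w)) (WithLp.toLp 2 y) :=
      continuous_const.inner (PiLp.continuous_toLp 2 _)
    exact (hc.tendsto _).comp (happ x)
  have hne : inner ℂ (WithLp.toLp 2 (A w)) (WithLp.toLp 2 (A w)) ≠ 0 := by
    simpa using hw
  have hlim : Tendsto (fun m => -(inner ℂ (WithLp.toLp 2 (A w)) (WithLp.toLp 2 (B m v)) /
      inner ℂ (WithLp.toLp 2 (A w)) (WithLp.toLp 2 (B m w)))) atTop (𝓝 0) := by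
    have h := ((hinner v).div (hinner w) hne).neg
    rw [hAv] at h
    simpa using h
  obtain ⟨m, ⟨hmM, hmne⟩, hmt⟩ := (((eventually_ge_atTop M).and
    ((hinner w).eventually_ne hne)).and
      (hlim.eventually (Metric.ball_mem_nhds 0 (half_pos hδ)))).exists
  -- τ solves a linear equation: the image of v + τ • w is orthogonal to A w. It lies in the disc
  -- for large m because B m v → A v = 0.
  set τ : ℂ := -(inner ℂ (WithLp.toLp 2 (A w)) (WithLp.toLp 2 (B m v)) /
      inner ℂ (WithLp.toLp 2 (A w)) (WithLp.toLp 2 (B m w))) with hτ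
  have horth : inner ℂ (WithLp.toLp 2 (A w)) (WithLp.toLp 2 (B m (v + τ • w))) = 0 := by
    rw [map_add, map_smul, WithLp.toLp_add, WithLp.toLp_smul, inner_add_right, inner_smul_right, hτ]
    field_simp
    ring
  have hang : lineAngle (B m (v + τ • w)) (A w) = Real.pi / 2 := by
    rw [lineAngle_comm]
    unfold lineAngle
    rw [horth]
    simp
  have hcont : ContinuousAt (fun t : ℂ => lineAngle (B m (v + t • w)) (A w)) τ := by
    refine ContinuousAt.comp (g := fun x => lineAngle x (A w))
      (continuousAt_lineAngle (hBne m _ (hx τ)) hw) ?_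
    fun_prop
  have h1 : ∀ᶠ t in 𝓝 τ, (3 / 4 : ℝ) < lineAngle (B m (v + t • w)) (A w) :=
    hcont.eventually (lt_mem_nhds (by
      change _ < lineAngle (B m (v + τ • w)) (A w)
      linarith [Real.pi_gt_three]))
  have h2 : ∀ᶠ t in 𝓝 τ, t ∈ Metric.ball (0 : ℂ) (δ / 2) := Metric.isOpen_ball.mem_nhds hmt
  -- τ itself may be 0, where `key` says nothing; by continuity a nearby nonzero t serves instead.
  have h3 : ∀ᶠ t : ℂ in 𝓝[≠] τ, t ≠ 0 := by
    rcases eq_or_ne τ 0 with h | h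
    · rw [h]; exact self_mem_nhdsWithin
    · exact (eventually_ne_nhds h).filter_mono nhdsWithin_le_nhds
  obtain ⟨t, ⟨ht1, ht2⟩, ht3⟩ :=
    (((h1.and h2).filter_mono nhdsWithin_le_nhds).and h3).exists
  have := key m hmM t ht3 (mem_ball_zero_iff.mp ht2).le
  linarith

end Geometry

/-! ### Growth of powers on generalized eigenspaces and their normalised limits. -/

section Asymptotics

/-- The binomial theorem with a number of terms independent of m: nilpotency removes the terms l >
d, and C(m,l) = 0 removes those with l > m. -/
lemma one_add_pow_eq_sum {R : Type*} [Semiring R] {N : R} {d : ℕ} (hN : N ^ (d + 1) = 0)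
    (m : ℕ) : (1 + N) ^ m = ∑ l ∈ Finset.range (d + 1), m.choose l • N ^ l := by
  rw [add_comm, (Commute.one_right N).add_pow]
  simp only [one_pow, mul_one]
  have h1 : ∑ l ∈ Finset.range (m + 1), N ^ l * (m.choose l : R) =
      ∑ l ∈ Finset.range (max m d + 1), N ^ l * (m.choose l : R) := by
    refine Finset.sum_subset (Finset.range_mono (by omega)) fun l _ hl => ?_
    rw [Nat.choose_eq_zero_of_lt (by simpa using hl)]; simp
  have h2 : ∑ l ∈ Finset.range (d + 1), m.choose l • N ^ l =
      ∑ l ∈ Finset.range (max m d + 1), m.choose l • N ^ l := by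
    refine Finset.sum_subset (Finset.range_mono (by omega)) fun l _ hl => ?_
    rw [pow_eq_zero_of_le (by simpa using hl) hN, smul_zero]
  rw [h1, h2]
  exact Finset.sum_congr rfl fun l _ => by rw [nsmul_eq_mul, Nat.cast_comm]

lemma tendsto_choose_div_choose {l d : ℕ} (h : l < d) :
    Tendsto (fun m : ℕ => (m.choose d : ℂ)⁻¹ * (m.choose l : ℂ)) atTop (𝓝 0) := by
  have h1 : (fun m : ℕ => (m.choose l : ℝ)) =o[atTop] fun m : ℕ => (m.choose d : ℝ) := by
    refine ((isTheta_choose l).1.trans_isLittleO ?_).trans_isBigO (isTheta_choose d).2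
    exact (Asymptotics.isLittleO_pow_pow_atTop_of_lt h).comp_tendsto tendsto_natCast_atTop_atTop
  have h2 := (Complex.continuous_ofReal.tendsto _).comp h1.tendsto_div_nhds_zero
  refine (by simpa using h2 : Tendsto _ atTop (𝓝 (0 : ℂ))).congr fun m => ?_
  simp [div_eq_inv_mul]

lemma tendsto_pow_mul_choose {θ : ℂ} (hθ : ‖θ‖ < 1) (l : ℕ) :
    Tendsto (fun m : ℕ => θ ^ m * (m.choose l : ℂ)) atTop (𝓝 0) := by
  have h := tendsto_pow_const_mul_const_pow_of_abs_lt_one l (r := ‖θ‖) (by simpa using hθ)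
  refine squeeze_zero_norm (fun m => ?_) h
  rw [norm_mul, norm_pow, Complex.norm_natCast, mul_comm]
  gcongr
  exact_mod_cast Nat.choose_le_pow m l

variable {E : Type*} [NormedAddCommGroup E] [NormedSpace ℂ E]
  {X : Type*} [AddCommGroup X] [Module ℂ X]

lemma pow_apply_of_intertwine {S : E →ₗ[ℂ] E} {f : X →ₗ[ℂ] E} {N : Module.End ℂ X} {θ : ℂ}
    (hS : ∀ u, S (f u) = θ • f (u + N u)) (m : ℕ) (u : X) :
    (S ^ m) (f u) = θ ^ m • f (((1 + N) ^ m) u) := by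
  induction m with
  | zero => simp
  | succ m ih =>
    rw [pow_succ', Module.End.mul_apply, ih, map_smul, hS, smul_smul, ← pow_succ, pow_succ' (1 + N)]
    rfl

/-- The unipotent factor grows only polynomially in m, and (θ/ρ)^m decays exponentially. -/
lemma tendsto_pow_apply_zero {S : E →ₗ[ℂ] E} {f : X →ₗ[ℂ] E} {N : Module.End ℂ X} {θ : ℂ}
    (hS : ∀ u, S (f u) = θ • f (u + N u)) (hN : IsNilpotent N) {ρ : ℝ} (hρ : ‖θ‖ < ρ) (u : X) :
    Tendsto (fun m : ℕ => ((ρ : ℂ) ^ m)⁻¹ • (S ^ m) (f u)) atTop (𝓝 0) := by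
  obtain ⟨d, hd⟩ := hN
  have hd' : N ^ (d + 1) = 0 := by rw [pow_succ, hd, zero_mul]
  have hρ0 : 0 < ρ := (norm_nonneg _).trans_lt hρ
  have hlt : ‖θ / ρ‖ < 1 := by
    rw [norm_div, Complex.norm_real, Real.norm_of_nonneg hρ0.le]
    exact (div_lt_one hρ0).mpr hρ
  have h : Tendsto (fun m : ℕ => ∑ l ∈ Finset.range (d + 1),
      ((θ / ρ) ^ m * (m.choose l : ℂ)) • f ((N ^ l) u)) atTop
      (𝓝 (∑ l ∈ Finset.range (d + 1), (0 : ℂ) • f ((N ^ l) u))) :=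
    tendsto_finsetSum _ fun l _ => (tendsto_pow_mul_choose hlt l).smul_const _
  simp only [zero_smul, Finset.sum_const_zero] at h
  refine h.congr fun m => ?_
  rw [pow_apply_of_intertwine hS, one_add_pow_eq_sum hd', smul_smul, LinearMap.sum_apply,
    map_sum, Finset.smul_sum]
  refine Finset.sum_congr rfl fun l _ => ?_
  rw [LinearMap.smul_apply, map_nsmul, ← Nat.cast_smul_eq_nsmul ℂ, smul_smul, div_pow]
  congr 1
  ring

/-- C(m,l) has order m^l, so after division by C(m,d) only the term l = d survives. -/
lemma tendsto_inv_choose_smul {f : X →ₗ[ℂ] E} {N : Module.End ℂ X} {d : ℕ}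
    (hN : N ^ (d + 1) = 0) (u : X) :
    Tendsto (fun m : ℕ => (m.choose d : ℂ)⁻¹ • f (((1 + N) ^ m) u)) atTop (𝓝 (f ((N ^ d) u))) := by
  have h : Tendsto (fun m : ℕ => (∑ l ∈ Finset.range d,
      ((m.choose d : ℂ)⁻¹ * (m.choose l : ℂ)) • f ((N ^ l) u)) + f ((N ^ d) u)) atTop
      (𝓝 ((∑ l ∈ Finset.range d, (0 : ℂ) • f ((N ^ l) u)) + f ((N ^ d) u))) :=
    (tendsto_finsetSum _ fun l hl =>
      (tendsto_choose_div_choose (Finset.mem_range.mp hl)).smul_const _).add_const _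
  simp only [zero_smul, Finset.sum_const_zero, zero_add] at h
  refine h.congr' ?_
  filter_upwards [eventually_ge_atTop d] with m hm
  have hc : (m.choose d : ℂ) ≠ 0 := by exact_mod_cast (Nat.choose_pos hm).ne'
  rw [one_add_pow_eq_sum hN, LinearMap.sum_apply, map_sum, Finset.smul_sum,
    Finset.sum_range_succ]
  congr 1
  · refine Finset.sum_congr rfl fun l _ => ?_
    rw [LinearMap.smul_apply, map_nsmul, ← Nat.cast_smul_eq_nsmul ℂ, smul_smul]
  · rw [LinearMap.smul_apply, map_nsmul, ← Nat.cast_smul_eq_nsmul ℂ, smul_smul,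
      inv_mul_cancel₀ hc, one_smul]

/-- On a finite-dimensional space, pointwise convergence of operators is norm convergence. -/
lemma exists_tendsto_of_pointwise [FiniteDimensional ℂ E] {B : ℕ → E →L[ℂ] E}
    (h : ∀ v, ∃ l, Tendsto (fun m => B m v) atTop (𝓝 l)) :
    ∃ A : E →L[ℂ] E, Tendsto B atTop (𝓝 A) := by
  let b := Module.finBasis ℂ E
  let Ψ : (Fin (Module.finrank ℂ E) → E) →ₗ[ℂ] (E →L[ℂ] E) :=
    (LinearMap.toContinuousLinearMap (𝕜 := ℂ) (E := E) (F' := E)).toLinearMap ∘ₗ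
      (b.constr ℂ).toLinearMap
  have hΨ : Continuous Ψ := LinearMap.continuous_of_finiteDimensional Ψ
  have hB : ∀ m, Ψ (fun i => B m (b i)) = B m := by
    intro m
    have : b.constr ℂ (fun i => B m (b i)) = (B m : E →ₗ[ℂ] E) :=
      b.ext fun i => by simp
    ext v
    exact LinearMap.congr_fun this v
  choose l hl using fun i => h (b i)
  refine ⟨Ψ l, ?_⟩
  have h1 : Tendsto (fun m i => B m (b i)) atTop (𝓝 l) := tendsto_pi_nhds.mpr hl
  exact ((hΨ.tendsto l).comp h1).congr hB

/-- Suppose that `S` acts as `θᵢ (1 + Nᵢ)` on the summands `Uᵢ` of a decomposition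
`E = W ⊕ ⨁ Uᵢ`, where `|θᵢ| = ρ` and `Nᵢ ^ (d + 1) = 0`, and that `ρ⁻ᵐ Sᵐ` tends to zero on `W`.
Then along every sequence of exponents the normalised powers of `S` subconverge to an operator
whose kernel is `W ⊕ ⨁ ker Nᵢ ^ d`. -/
theorem exists_subseq_tendsto_normalized_pow [FiniteDimensional ℂ E] {S : E →ₗ[ℂ] E}
    {ι : Type*} [Fintype ι] {U : ι → Type*} [∀ i, AddCommGroup (U i)] [∀ i, Module ℂ (U i)]
    (f : ∀ i, U i →ₗ[ℂ] E) (W : Submodule ℂ E)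
    (hsurj : ∀ v, ∃ w ∈ W, ∃ u : ∀ i, U i, v = w + ∑ i, f i (u i))
    (hinj : ∀ u : ∀ i, U i, ∑ i, f i (u i) = 0 → u = 0)
    {N : ∀ i, Module.End ℂ (U i)} {θ : ι → ℂ} {ρ : ℝ} (hρ : 0 < ρ) (hθ : ∀ i, ‖θ i‖ = ρ)
    (hS : ∀ i u, S (f i u) = θ i • f i (u + N i u)) {d : ℕ} (hN : ∀ i, N i ^ (d + 1) = 0)
    (hW : ∀ w ∈ W, Tendsto (fun m : ℕ => ((ρ : ℂ) ^ m)⁻¹ • (S ^ m) w) atTop (𝓝 0))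
    {e : ℕ → ℕ} (he : Tendsto e atTop atTop) :
    ∃ φ : ℕ → ℕ, StrictMono φ ∧ ∃ c : ℕ → ℂ, (∀ j, c j ≠ 0) ∧ ∃ A : E →L[ℂ] E,
      Tendsto (fun j => c j • LinearMap.toContinuousLinearMap (S ^ e (φ j))) atTop (𝓝 A) ∧
      ∀ w ∈ W, ∀ u : ∀ i, U i, A (w + ∑ i, f i (u i)) = 0 ↔ ∀ i, (N i ^ d) (u i) = 0 := by
  have hρ' : (ρ : ℂ) ≠ 0 := by exact_mod_cast hρ.ne'
  have hunit : ∀ i, ‖θ i / ρ‖ = 1 := fun i => by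
    rw [norm_div, hθ, Complex.norm_real, Real.norm_of_nonneg hρ.le, div_self hρ.ne']
  -- The phases of all blocks lie in a compact torus and so converge jointly along a subsequence.
  -- The limits are nonzero and therefore do not affect the kernel.
  obtain ⟨μ, hμ, φ, hφ, hlim⟩ :=
    (isCompact_univ_pi fun _ : ι => isCompact_sphere (0 : ℂ) 1).tendsto_subseq
      (x := fun j i => (θ i / ρ) ^ e j) fun j i _ => by
        rw [mem_sphere_zero_iff_norm, norm_pow, hunit, one_pow]
  have hμ1 : ∀ i, μ i ≠ 0 := fun i h => by
    have := hμ i (Set.mem_univ i)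
    simp [h] at this
  have heφ : Tendsto (fun j => e (φ j)) atTop atTop := he.comp hφ.tendsto_atTop
  -- C(e,d) vanishes for e < d; replacing it by 1 there keeps every c j nonzero and changes only
  -- finitely many terms.
  let c : ℕ → ℂ := fun j =>
    ((ρ : ℂ) ^ e (φ j))⁻¹ * (if e (φ j) < d then 1 else ((e (φ j)).choose d : ℂ)⁻¹)
  have hc : ∀ j, c j ≠ 0 := by
    intro j
    refine mul_ne_zero (inv_ne_zero (pow_ne_zero _ hρ')) ?_
    split_ifs with h
    · exact one_ne_zero
    · exact inv_ne_zero (by exact_mod_cast (Nat.choose_pos (not_lt.mp h)).ne')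
  have hclim : ∀ᶠ j in atTop,
      c j = ((ρ : ℂ) ^ e (φ j))⁻¹ * ((e (φ j)).choose d : ℂ)⁻¹ := by
    filter_upwards [heφ.eventually_ge_atTop d] with j hj
    simp [c, not_lt.mpr hj]
  have hAW : ∀ w ∈ W, Tendsto (fun j => c j • (S ^ e (φ j)) w) atTop (𝓝 0) := by
    intro w hw
    have h1 := ((hW w hw).comp heφ).norm
    rw [norm_zero] at h1
    refine squeeze_zero_norm (fun j => ?_) h1
    simp only [c, Function.comp_apply]
    rw [mul_comm, mul_smul, norm_smul]
    refine mul_le_of_le_one_left (norm_nonneg _) ?_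
    split_ifs with h
    · simp
    · rw [norm_inv, Complex.norm_natCast]
      exact inv_le_one_of_one_le₀ (by exact_mod_cast Nat.choose_pos (not_lt.mp h))
  have hAU : ∀ i u, Tendsto (fun j => c j • (S ^ e (φ j)) (f i u)) atTop
      (𝓝 (μ i • f i ((N i ^ d) u))) := by
    intro i u
    have h1 := (tendsto_pi_nhds.mp hlim i).smul
      ((tendsto_inv_choose_smul (f := f i) (hN i) u).comp heφ)
    refine h1.congr' ?_
    filter_upwards [hclim] with j hj
    rw [hj, pow_apply_of_intertwine (hS i)]
    simp only [Function.comp_apply, smul_smul, div_pow]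
    congr 1
    ring
  have hAsum : ∀ w ∈ W, ∀ u : ∀ i, U i,
      Tendsto (fun j => c j • (S ^ e (φ j)) (w + ∑ i, f i (u i))) atTop
        (𝓝 (∑ i, f i (μ i • (N i ^ d) (u i)))) := by
    intro w hw u
    have h1 := (hAW w hw).add (tendsto_finsetSum Finset.univ fun i _ => hAU i (u i))
    rw [zero_add] at h1
    simp only [map_smul]
    refine h1.congr fun j => ?_
    rw [map_add, map_sum, smul_add, Finset.smul_sum]
  obtain ⟨A, hA⟩ := exists_tendsto_of_pointwise
    (B := fun j => c j • LinearMap.toContinuousLinearMap (S ^ e (φ j))) fun v => by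
      obtain ⟨w, hw, u, rfl⟩ := hsurj v
      exact ⟨_, hAsum w hw u⟩
  refine ⟨φ, hφ, c, hc, A, hA, fun w hw u => ?_⟩
  have hval : A (w + ∑ i, f i (u i)) = ∑ i, f i (μ i • (N i ^ d) (u i)) :=
    tendsto_nhds_unique
      (((ContinuousLinearMap.apply ℂ E (w + ∑ i, f i (u i))).continuous.tendsto _).comp hA)
      (hAsum w hw u)
  rw [hval]
  constructor
  · intro h i
    have := congr_fun (hinj (fun i => μ i • (N i ^ d) (u i)) h) i
    exact (smul_eq_zero.mp this).resolve_left (hμ1 i)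
  · intro h
    exact Finset.sum_eq_zero fun i _ => by rw [h i]; simp

end Asymptotics

/-! ### Linear algebra of a block decomposition and the description of Ξ by kernels. -/

namespace BlockDecomposition

open Module

variable {E : Type*} [AddCommGroup E] [Module ℂ E] [FiniteDimensional ℂ E] {T : E →ₗ[ℂ] E}
  (B : BlockDecomposition T)

lemma op_sub_one_pow_finrank (i : Fin B.k) : (B.op i - 1) ^ finrank ℂ (B.V i) = 0 := by
  have h := LinearMap.aeval_self_charpoly (B.op i)
  rw [B.charpoly_eq i] at h
  simpa using h

lemma finrank_le_H {i : Fin B.k} (h : B.op i ≠ LinearMap.id) : finrank ℂ (B.V i) ≤ B.H := by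
  classical
  exact Finset.le_sup (f := fun j => finrank ℂ (B.V j)) (by simpa using h)

/-- With truncated subtraction the exponent is max(H, 1): a positive exponent is needed for identity
blocks, where the nilpotent part is 0, also when H = 0. -/
lemma op_sub_one_pow_H (i : Fin B.k) : (B.op i - 1) ^ (B.H - 1 + 1) = 0 := by
  by_cases h : B.op i = LinearMap.id
  · rw [h, ← Module.End.one_eq_id, sub_self, pow_succ, mul_zero]
  · exact pow_eq_zero_of_le (by have := B.finrank_le_H h; omega) (B.op_sub_one_pow_finrank i)

lemma jordan_of_ne_id {i : Fin B.k} (h : B.op i ≠ LinearMap.id) :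
    LinearMap.toMatrix (B.basis i) (B.basis i) (B.op i) = jordanBlock (finrank ℂ (B.V i)) :=
  (B.id_or_jordan i).resolve_left h

lemma op_sub_one_apply {i : Fin B.k} (h : B.op i ≠ LinearMap.id) {b : ℕ}
    (hb : b < finrank ℂ (B.V i)) :
    (B.op i - 1) (B.basis i ⟨b, hb⟩) =
      if h : 1 ≤ b then B.basis i ⟨b - 1, by omega⟩ else 0 := by
  have h1 : B.op i (B.basis i ⟨b, hb⟩) =
      ∑ a, jordanBlock (finrank ℂ (B.V i)) a ⟨b, hb⟩ • B.basis i a := by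
    rw [← B.jordan_of_ne_id h, ← Matrix.toLin_self (B.basis i) (B.basis i), Matrix.toLin_toMatrix]
  rw [LinearMap.sub_apply, h1, Module.End.one_apply, sub_eq_iff_eq_add]
  have h2 : ∀ a : Fin (finrank ℂ (B.V i)), jordanBlock (finrank ℂ (B.V i)) a ⟨b, hb⟩ • B.basis i a =
      (if a = ⟨b, hb⟩ then B.basis i a else 0) +
        (if (a : ℕ) + 1 = b then B.basis i a else 0) := by
    intro a
    by_cases hab : a = ⟨b, hb⟩
    · subst hab; simp [jordanBlock]
    · by_cases hab' : (a : ℕ) + 1 = b <;> simp [jordanBlock, hab, hab']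
  rw [Finset.sum_congr rfl fun a _ => h2 a, Finset.sum_add_distrib, Finset.sum_ite_eq', add_comm]
  simp only [Finset.mem_univ, if_true]
  congr 1
  split_ifs with hb1
  · rw [Finset.sum_eq_single ⟨b - 1, by omega⟩]
    · simp [Nat.sub_add_cancel hb1]
    · intro a _ ha
      rw [if_neg]
      rintro rfl
      exact ha (Fin.ext (by simp))
    · simp
  · exact Finset.sum_eq_zero fun a _ => if_neg (by omega)

lemma op_sub_one_pow_apply {i : Fin B.k} (h : B.op i ≠ LinearMap.id) (l : ℕ) {b : ℕ}
    (hb : b < finrank ℂ (B.V i)) :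
    ((B.op i - 1) ^ l) (B.basis i ⟨b, hb⟩) =
      if h : l ≤ b then B.basis i ⟨b - l, by omega⟩ else 0 := by
  induction l generalizing b with
  | zero => simp
  | succ l ih =>
    rw [pow_succ, Module.End.mul_apply, B.op_sub_one_apply h hb]
    by_cases hb1 : 1 ≤ b
    · rw [dif_pos hb1, ih]
      by_cases hl : l + 1 ≤ b
      · rw [dif_pos hl, dif_pos (by omega)]
        congr 2
        omega
      · rw [dif_neg hl, dif_neg (by omega)]
    · rw [dif_neg hb1, map_zero, dif_neg (by omega)]

lemma op_sub_one_pow_ne_zero {i : Fin B.k} (h : B.op i ≠ LinearMap.id)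
    (hi : finrank ℂ (B.V i) = B.H) (hH : 2 ≤ B.H) : (B.op i - 1) ^ (B.H - 1) ≠ 0 := by
  intro h0
  have hb : B.H - 1 < finrank ℂ (B.V i) := by omega
  have h1 := B.op_sub_one_pow_apply h (B.H - 1) hb
  rw [h0, dif_pos le_rfl] at h1
  exact (B.basis i).ne_zero _ h1.symm

/-- This makes the limit operator nonzero. For H ≥ 2 a block attaining the maximum works; for H < 2
the power is the identity, and some block is nonzero. -/
lemma exists_op_sub_one_pow_ne_zero [Nontrivial E] :
    ∃ i, ∃ u, ((B.op i - 1) ^ (B.H - 1)) u ≠ 0 := by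
  classical
  by_cases hH : B.H < 2
  · have : B.H - 1 = 0 := by omega
    by_contra! h
    simp only [this, pow_zero, Module.End.one_apply] at h
    have hbot : ∀ i, B.V i = ⊥ := fun i => by
      rw [Submodule.eq_bot_iff]
      exact fun x hx => congrArg Subtype.val (h i ⟨x, hx⟩)
    have htop : (⨆ i, B.V i) = ⊤ := B.isInternal.submodule_iSup_eq_top
    simp [hbot] at htop
  · have hne : (Finset.univ.filter fun j : Fin B.k => B.op j ≠ LinearMap.id).Nonempty := by
      by_contra h
      rw [Finset.not_nonempty_iff_eq_empty] at h
      have h0 : B.H = 0 := by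
        unfold H
        convert! Finset.sup_empty (f := fun j => finrank ℂ (B.V j))
      omega
    obtain ⟨i, hi, hiH⟩ := Finset.exists_mem_eq_sup _ hne fun j => finrank ℂ (B.V j)
    have hi' : finrank ℂ (B.V i) = B.H := by
      unfold H
      convert! hiH.symm
    by_contra! h
    exact B.op_sub_one_pow_ne_zero (by simpa using hi) hi' (by omega) (LinearMap.ext (h i))

lemma op_ne_id_of_pow_apply_ne_zero (hH : 2 ≤ B.H) {i : Fin B.k} {u : B.V i}
    (hu : ((B.op i - 1) ^ (B.H - 1)) u ≠ 0) : B.op i ≠ LinearMap.id := by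
  intro h
  rw [h, ← Module.End.one_eq_id, sub_self, zero_pow (by omega)] at hu
  exact hu rfl

/-- The nilpotent part shifts the basis down by one, so H-1 shifts leave something only from index
at least H-1, while non-identity blocks have dimension at most H. -/
lemma eq_last_of_pow_apply_ne_zero (hH : 2 ≤ B.H) {i : Fin B.k} {b : Fin (finrank ℂ (B.V i))}
    (hu : ((B.op i - 1) ^ (B.H - 1)) (B.basis i b) ≠ 0) :
    finrank ℂ (B.V i) = B.H ∧ (b : ℕ) = B.H - 1 := by
  have hid := B.op_ne_id_of_pow_apply_ne_zero hH hu
  have hle := B.finrank_le_H hid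
  have h1 := B.op_sub_one_pow_apply hid (B.H - 1) b.2
  have h2 : B.H - 1 ≤ b := by
    by_contra h
    rw [dif_neg h] at h1
    exact hu h1
  have := b.2
  omega

lemma pow_mem_span_orbit (i : Fin B.k) (w : B.V i) (l : ℕ) :
    ((B.op i - 1) ^ l) w ∈ Submodule.span ℂ (B.orbit i w) := by
  set P := Submodule.span ℂ (Set.range fun m => (B.op i ^ m) w)
  have hP : P ≤ P.comap (B.op i) := by
    rw [Submodule.span_le]
    rintro _ ⟨m, rfl⟩
    exact Submodule.subset_span ⟨m + 1, by simp only [pow_succ', Module.End.mul_apply]⟩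
  have h : ((B.op i - 1) ^ l) w ∈ P := by
    induction l with
    | zero => exact Submodule.subset_span ⟨0, rfl⟩
    | succ l ih =>
      rw [pow_succ', Module.End.mul_apply]
      exact P.sub_mem (hP ih) ih
  refine Submodule.span_mono ?_ h
  rintro _ ⟨m, rfl⟩
  exact ⟨m, Or.inl rfl⟩

/-- The surviving vector is the last one of its block, and powers of the nilpotent part carry it to
every other basis vector. -/
lemma span_orbit_eq_top (hH : 2 ≤ B.H) {i : Fin B.k} {b : Fin (finrank ℂ (B.V i))}
    (hu : ((B.op i - 1) ^ (B.H - 1)) (B.basis i b) ≠ 0) :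
    Submodule.span ℂ (B.orbit i (B.basis i b)) = ⊤ := by
  have hid := B.op_ne_id_of_pow_apply_ne_zero hH hu
  obtain ⟨hi, hb⟩ := B.eq_last_of_pow_apply_ne_zero hH hu
  rw [eq_top_iff, ← (B.basis i).span_eq, Submodule.span_le]
  rintro _ ⟨a, rfl⟩
  have h1 := B.op_sub_one_pow_apply hid (b - a) b.2
  rw [dif_pos (Nat.sub_le _ _)] at h1
  have h2 : (⟨(b : ℕ) - (b - a), by omega⟩ : Fin (finrank ℂ (B.V i))) = a := by
    have := a.2
    ext
    simp only
    omega
  rw [h2] at h1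
  rw [← h1]
  exact B.pow_mem_span_orbit i _ _

/-- Powers of the block operator commute with those of its nilpotent part. For preimages injectivity
is needed: on a vector killed by the block operator the nilpotent part acts as -1, so the vector is
0. -/
lemma orbit_subset_ker {i : Fin B.k} {w : B.V i} (l : ℕ) (hw : ((B.op i - 1) ^ l) w = 0) :
    B.orbit i w ⊆ LinearMap.ker ((B.op i - 1) ^ l) := by
  have hcomm : ∀ m, Commute (B.op i ^ m) ((B.op i - 1) ^ l) := fun m =>
    ((Commute.refl (B.op i)).sub_right (Commute.one_right _)).pow_pow m l
  have hinj : Function.Injective (B.op i) := by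
    rw [← LinearMap.ker_eq_bot, LinearMap.ker_eq_bot']
    intro v hv
    have h1 : ∀ m, ((B.op i - 1) ^ m) v = (-1 : ℂ) ^ m • v := by
      intro m
      induction m with
      | zero => simp
      | succ m ih =>
        rw [pow_succ', Module.End.mul_apply, ih, map_smul, LinearMap.sub_apply, hv, pow_succ]
        simp
    have h2 := h1 (finrank ℂ (B.V i))
    rw [B.op_sub_one_pow_finrank] at h2
    simpa using h2.symm
  rintro u ⟨m, rfl | rfl⟩
  · change ((B.op i - 1) ^ l) _ = 0
    rw [← Module.End.mul_apply, ← (hcomm m).eq, Module.End.mul_apply, hw, map_zero]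
  · change ((B.op i - 1) ^ l) _ = 0
    rw [← Module.End.mul_apply, ← (hcomm m).eq, Module.End.mul_apply, Module.End.pow_apply] at hw
    exact hinj.iterate m (by rw [hw, ← Module.End.pow_apply, map_zero])

/-- On an identity block the orbit is a single point, of span at most 1 < H. Otherwise it stays in
the kernel of the power H-1, a proper subspace when the block has dimension H. -/
lemma finrank_span_orbit_lt (hH : 2 ≤ B.H) {i : Fin B.k} {w : B.V i}
    (hi : finrank ℂ (B.V i) = B.H) (hw : ((B.op i - 1) ^ (B.H - 1)) w = 0) :
    finrank ℂ (Submodule.span ℂ (B.orbit i w)) < B.H := by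
  by_cases h : B.op i = LinearMap.id
  · have h1 : B.orbit i w ⊆ {w} := by
      rintro u ⟨m, rfl | rfl⟩ <;> simp [h, ← Module.End.one_eq_id]
    have h2 : finrank ℂ (Submodule.span ℂ (B.orbit i w)) ≤
        finrank ℂ (Submodule.span ℂ {w}) :=
      Submodule.finrank_mono (Submodule.span_mono h1)
    have h3 := finrank_span_le_card (R := ℂ) ({w} : Set (B.V i))
    simp at h3
    omega
  · have h1 : Submodule.span ℂ (B.orbit i w) ≤ LinearMap.ker ((B.op i - 1) ^ (B.H - 1)) :=
      Submodule.span_le.mpr (B.orbit_subset_ker _ hw)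
    have h2 : LinearMap.ker ((B.op i - 1) ^ (B.H - 1)) ≠ ⊤ := fun h' =>
      B.op_sub_one_pow_ne_zero h hi hH (LinearMap.ker_eq_top.mp h')
    have h3 := Submodule.finrank_lt h2
    have h4 := Submodule.finrank_mono h1
    omega

/-- The vectors to be removed are recorded only as elements of E, so it must be excluded that w is
also a basis vector of another block; independence of the blocks does this. -/
lemma notMem_topVectors (hH : 2 ≤ B.H) {i : Fin B.k} {b : Fin (finrank ℂ (B.V i))}
    (hw : ((B.op i - 1) ^ (B.H - 1)) (B.basis i b) = 0) :
    (B.basis i b : E) ∉ B.topVectors := by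
  rintro ⟨j, a, hja, hj, hfin⟩
  obtain rfl : i = j := by
    by_contra hij
    have hd := B.isInternal.submodule_iSupIndep.pairwiseDisjoint hij
    have h0 := Submodule.disjoint_def.mp hd _ (B.basis i b).2 (hja ▸ (B.basis j a).2)
    exact (B.basis i).ne_zero b (Subtype.ext h0)
  rw [← Subtype.ext hja] at hfin
  have := B.finrank_span_orbit_lt hH hj hw
  omega

/-- `Ξ(T)` spans the direct sum of the kernels of the operators `(Tᵢ - 1) ^ (H - 1)`. -/
theorem span_Xi : Submodule.span ℂ B.Xi =
    ⨆ i, (LinearMap.ker ((B.op i - 1) ^ (B.H - 1))).map (B.V i).subtype := by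
  unfold Xi
  split_ifs with hH
  -- The exponent is 0, so the kernels are trivial, in agreement with Ξ = ∅.
  · have h0 : B.H - 1 = 0 := by omega
    simp [h0, Module.End.one_eq_id]
  · have hH : 2 ≤ B.H := by omega
    rw [Submodule.span_eq]
    apply le_antisymm
    · rw [Submodule.span_le]
      rintro _ ⟨⟨i, b, rfl⟩, hw⟩
      refine Submodule.mem_iSup_of_mem i ⟨B.basis i b, ?_, rfl⟩
      by_contra hne
      have h1 : ((B.op i - 1) ^ (B.H - 1)) (B.basis i b) ≠ 0 := hne
      have h2 := (B.eq_last_of_pow_apply_ne_zero hH h1).1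
      refine hw ⟨i, b, rfl, h2, ?_⟩
      rw [B.span_orbit_eq_top hH h1, finrank_top, h2]
    · refine iSup_le fun i => ?_
      rintro _ ⟨u, hu, rfl⟩
      have hu : ((B.op i - 1) ^ (B.H - 1)) u = 0 := hu
      rw [Submodule.subtype_apply, ← (B.basis i).sum_repr u, Submodule.coe_sum]
      refine Submodule.sum_mem _ fun b _ => ?_
      rw [Submodule.coe_smul]
      by_cases hb : ((B.op i - 1) ^ (B.H - 1)) (B.basis i b) = 0
      · exact Submodule.smul_mem _ _
          (Submodule.subset_span ⟨⟨i, b, rfl⟩, B.notMem_topVectors hH hb⟩)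
      -- At most one basis vector of a block is not killed, so a vector of the kernel has
      -- coefficient 0 there.
      · have h1 : (B.basis i).repr u b • ((B.op i - 1) ^ (B.H - 1)) (B.basis i b) = 0 := by
          rw [← (B.basis i).sum_repr u, map_sum, Finset.sum_eq_single b, map_smul] at hu
          · exact hu
          · intro a _ hab
            rw [map_smul]
            by_contra ha
            have ha' := (B.eq_last_of_pow_apply_ne_zero hH (right_ne_zero_of_smul ha)).2
            have hb' := (B.eq_last_of_pow_apply_ne_zero hH hb).2
            exact hab (Fin.ext (by omega))
          · simp
        rw [(smul_eq_zero.mp h1).resolve_right hb, zero_smul]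
        exact Submodule.zero_mem _

end BlockDecomposition

/-! ### Existence of block decompositions: the Jordan normal form. -/

section Jordan

open Module Polynomial DirectSum

lemma isInternal_range_comp_lof {R ι E : Type*} [Ring R] [DecidableEq ι] {Q : ι → Type*}
    [∀ i, AddCommGroup (Q i)] [∀ i, Module R (Q i)] [AddCommGroup E] [Module R E]
    (ψ : (⨁ i, Q i) ≃ₗ[R] E) :
    DirectSum.IsInternal fun i => LinearMap.range (ψ.toLinearMap ∘ₗ DirectSum.lof R ι Q i) := by
  have hinj : ∀ i, Function.Injective (ψ.toLinearMap ∘ₗ DirectSum.lof R ι Q i) := fun i =>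
    ψ.injective.comp (DirectSum.of_injective i)
  let ε : (⨁ i, Q i) ≃ₗ[R] ⨁ i, LinearMap.range (ψ.toLinearMap ∘ₗ DirectSum.lof R ι Q i) :=
    DFinsupp.mapRange.linearEquiv fun i => LinearEquiv.ofInjective _ (hinj i)
  have h : DirectSum.coeLinearMap _ ∘ₗ ε.toLinearMap = ψ.toLinearMap := by
    refine DirectSum.linearMap_ext R fun i => LinearMap.ext fun q => ?_
    have : ε (DirectSum.lof R ι Q i q) = DirectSum.lof R ι _ i
        (LinearEquiv.ofInjective _ (hinj i) q) :=
      DFinsupp.mapRange_single (hf := fun i => map_zero _)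
    simp only [LinearMap.comp_apply, LinearEquiv.coe_coe, this]
    erw [DirectSum.coeLinearMap_lof]
    rfl
  have h2 : (DirectSum.coeLinearMap fun i =>
      LinearMap.range (ψ.toLinearMap ∘ₗ DirectSum.lof R ι Q i)) =
      ψ.toLinearMap ∘ₗ ε.symm.toLinearMap := by
    refine LinearMap.ext fun x => ?_
    have := LinearMap.congr_fun h (ε.symm x)
    simpa using this
  have h3 : Function.Bijective (DirectSum.coeLinearMap fun i =>
      LinearMap.range (ψ.toLinearMap ∘ₗ DirectSum.lof R ι Q i)) := by
    rw [h2]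
    exact ψ.bijective.comp ε.symm.bijective
  exact h3

/-- A finite-dimensional space with an endomorphism is a direct sum of cyclic subspaces whose
annihilators are powers of irreducible polynomials. -/
theorem exists_isInternal_cyclic {K E : Type*} [Field K] [AddCommGroup E] [Module K E]
    [FiniteDimensional K E] (T : E →ₗ[K] E) :
    ∃ (k : ℕ) (U : Fin k → Submodule K E) (x : Fin k → E) (p : Fin k → K[X]) (e : Fin k → ℕ),
      DirectSum.IsInternal U ∧ (∀ i, Irreducible (p i)) ∧
      (∀ i v, v ∈ U i ↔ ∃ f : K[X], v = aeval T f (x i)) ∧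
      ∀ i (f : K[X]), aeval T f (x i) = 0 ↔ p i ^ e i ∣ f := by
  classical
  -- E becomes a torsion K[X]-module with X acting as T, to which the structure theorem over a
  -- principal ideal domain applies; the class of 1 in each factor gives the cyclic generator.
  obtain ⟨ι, _, p, hp, e, ⟨E₀⟩⟩ := Module.equiv_directSum_of_isTorsion
    (R := K[X]) (M := AEval' T) (AEval.isTorsion_of_finiteDimensional K E T)
  let σ : Fin (Fintype.card ι) ≃ ι := (Fintype.equivFin ι).symm
  let Q : Fin (Fintype.card ι) → Type _ := fun i => K[X] ⧸ K[X] ∙ p (σ i) ^ e (σ i)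
  let E₁ : AEval' T ≃ₗ[K[X]] ⨁ i, Q i :=
    E₀.trans (DirectSum.lequivCongrLeft K[X] σ.symm)
  let ψ : (⨁ i, Q i) ≃ₗ[K] E := (E₁.symm.restrictScalars K).trans (AEval'.of T).symm
  let x : Fin (Fintype.card ι) → E := fun i =>
    ψ (DirectSum.lof K _ Q i (Submodule.Quotient.mk 1))
  have hx : ∀ i (f : K[X]), ψ (DirectSum.lof K _ Q i (Submodule.Quotient.mk f)) =
      aeval T f (x i) := by
    intro i f
    have h1 : DirectSum.lof K _ Q i (Submodule.Quotient.mk f) =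
        f • DirectSum.lof K[X] _ Q i (Submodule.Quotient.mk 1) := by
      rw [← map_smul, ← Submodule.Quotient.mk_smul, smul_eq_mul, mul_one]
      rfl
    have h2 : ψ (f • DirectSum.lof K[X] _ Q i (Submodule.Quotient.mk 1)) =
        (AEval'.of T).symm (f • E₁.symm (DirectSum.lof K[X] _ Q i (Submodule.Quotient.mk 1))) := by
      rw [← map_smul E₁.symm]
      rfl
    rw [h1, h2]
    exact AEval.of_symm_smul _ f _
  refine ⟨Fintype.card ι, fun i => LinearMap.range (ψ.toLinearMap ∘ₗ DirectSum.lof K _ Q i), x,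
    fun i => p (σ i), fun i => e (σ i), isInternal_range_comp_lof ψ, fun i => hp _, ?_, ?_⟩
  · intro i v
    constructor
    · rintro ⟨q, rfl⟩
      obtain ⟨f, rfl⟩ := Submodule.Quotient.mk_surjective _ q
      exact ⟨f, hx i f⟩
    · rintro ⟨f, rfl⟩
      exact ⟨_, hx i f⟩
  · intro i f
    have hinj : Function.Injective (DirectSum.lof K _ Q i) := DirectSum.of_injective i
    rw [← hx, LinearEquiv.map_eq_zero_iff, map_eq_zero_iff _ hinj,
      Submodule.Quotient.mk_eq_zero, Submodule.mem_span_singleton]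
    exact ⟨fun ⟨a, ha⟩ => ⟨a, by rw [← ha, smul_eq_mul, mul_comm]⟩,
      fun ⟨a, ha⟩ => ⟨a, by rw [ha, smul_eq_mul, mul_comm]⟩⟩

/-- In a relation whose largest index with nonzero coefficient is i, applying N^i kills the terms
below i and turns the i-th into a multiple of N^(e-1) x ≠ 0. The decreasing exponents match a
superdiagonal Jordan block. -/
lemma linearIndependent_pow_apply {K E : Type*} [Field K] [AddCommGroup E] [Module K E]
    {N : Module.End K E} {x : E} {e : ℕ} (h0 : (N ^ e) x = 0) (h1 : ∀ j < e, (N ^ j) x ≠ 0) :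
    LinearIndependent K fun j : Fin e => (N ^ (e - 1 - (j : ℕ))) x := by
  have hz : ∀ j, e ≤ j → (N ^ j) x = 0 := by
    intro j hj
    obtain ⟨i, rfl⟩ := Nat.exists_eq_add_of_le' hj
    rw [pow_add, Module.End.mul_apply, h0, map_zero]
  rw [Fintype.linearIndependent_iff]
  intro g hg
  by_contra! hne
  obtain ⟨i, hi, hmax⟩ : ∃ i, g i ≠ 0 ∧ ∀ j, i < j → g j = 0 := by
    obtain ⟨i, hi⟩ := (Set.toFinite {i | g i ≠ 0}).exists_maximal hne
    exact ⟨i, hi.1, fun j hj => by_contra fun h => hj.not_ge (hi.2 h hj.le)⟩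
  have h2 := congrArg (N ^ (i : ℕ)) hg
  rw [map_zero, map_sum, Finset.sum_eq_single i] at h2
  · rw [map_smul, ← Module.End.mul_apply, ← pow_add] at h2
    have hi2 := i.2
    exact (smul_ne_zero hi (h1 _ (by omega))) h2
  · intro j _ hji
    rcases lt_or_gt_of_ne hji with h | h
    · rw [map_smul, ← Module.End.mul_apply, ← pow_add, hz _ (by have := j.2; omega), smul_zero]
    · rw [hmax j h, zero_smul, map_zero]
  · simp

lemma jordanBlock_charpoly (d : ℕ) : (jordanBlock d).charpoly = (X - 1) ^ d := by
  rw [Matrix.charpoly_of_isUpperTriangular]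
  · simp [jordanBlock]
  · intro a b hab
    have hab : b < a := hab
    have h1 : a ≠ b := hab.ne'
    have h2 : ¬ (a : ℕ) + 1 = b := by have : (b : ℕ) < a := hab; omega
    simp [jordanBlock, h1, h2]

/-- Factoring μ out of T makes the nilpotent part N = μ⁻¹T - 1, so that N^(e-1) x, …, N x, x is a
basis in which μ⁻¹T has 1 on the superdiagonal. -/
lemma exists_jordanBlock_of_cyclic {E : Type*} [AddCommGroup E] [Module ℂ E]
    [FiniteDimensional ℂ E] {T : E →ₗ[ℂ] E} {U : Submodule ℂ E} {x : E} {μ : ℂ} (hμ : μ ≠ 0)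
    {e : ℕ} (h0 : ((μ⁻¹ • T - 1 : Module.End ℂ E) ^ e) x = 0)
    (h1 : ∀ j < e, ((μ⁻¹ • T - 1 : Module.End ℂ E) ^ j) x ≠ 0)
    (hU : ∀ v, v ∈ U ↔ ∃ f : ℂ[X], v = aeval T f x) :
    ∃ (b : Basis (Fin (finrank ℂ U)) ℂ U) (S : U →ₗ[ℂ] U),
      (∀ v : U, T v = μ • (S v : E)) ∧ LinearMap.toMatrix b b S = jordanBlock (finrank ℂ U) := by
  set N : Module.End ℂ E := μ⁻¹ • T - 1 with hN
  have hTU : ∀ v ∈ U, T v ∈ U := by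
    intro v hv
    obtain ⟨f, rfl⟩ := (hU v).mp hv
    exact (hU _).mpr ⟨X * f, by simp⟩
  have hNU : ∀ v ∈ U, N v ∈ U := fun v hv => U.sub_mem (U.smul_mem _ (hTU v hv)) hv
  have hxU : x ∈ U := (hU x).mpr ⟨1, by simp⟩
  have hNx : ∀ j, (N ^ j) x ∈ U := by
    intro j
    induction j with
    | zero => exact hxU
    | succ j ih => rw [pow_succ']; exact hNU _ ih
  have hz : ∀ j, e ≤ j → (N ^ j) x = 0 := by
    intro j hj
    obtain ⟨i, rfl⟩ := Nat.exists_eq_add_of_le' hj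
    rw [pow_add, Module.End.mul_apply, h0, map_zero]
  let v : Fin e → U := fun j => ⟨(N ^ (e - 1 - (j : ℕ))) x, hNx _⟩
  have hli : LinearIndependent ℂ v :=
    LinearIndependent.of_comp U.subtype (linearIndependent_pow_apply h0 h1)
  have hspan : ⊤ ≤ Submodule.span ℂ (Set.range v) := by
    rintro ⟨w, hw⟩ -
    have hmem : ∀ j, (⟨(N ^ j) x, hNx j⟩ : U) ∈ Submodule.span ℂ (Set.range v) := by
      intro j
      by_cases hj : j < e
      · refine Submodule.subset_span ⟨⟨e - 1 - j, by omega⟩, Subtype.ext ?_⟩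
        simp only [v]
        congr 2
        omega
      · have : (⟨(N ^ j) x, hNx j⟩ : U) = 0 := Subtype.ext (hz j (not_lt.mp hj))
        rw [this]
        exact Submodule.zero_mem _
    obtain ⟨f, hf⟩ := (hU w).mp hw
    have hTN : T - algebraMap ℂ (Module.End ℂ E) μ = μ • N := by
      rw [hN, smul_sub, smul_smul, mul_inv_cancel₀ hμ, one_smul, Algebra.algebraMap_eq_smul_one]
    -- Expanding f around μ and using T - μ = μN writes f(T) x as a combination of the vectors N^i
    -- x.
    have hf' : w = (taylor μ f).sum fun i a => (a * μ ^ i) • (N ^ i) x := by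
      rw [hf]
      conv_lhs => rw [← sum_taylor_eq f μ]
      simp only [Polynomial.sum, map_sum, map_mul, map_pow, map_sub, aeval_X, aeval_C,
        LinearMap.sum_apply, hTN, Module.End.mul_apply, Module.algebraMap_end_apply,
        _root_.smul_pow,
        LinearMap.smul_apply, smul_smul]
    have hw' : (⟨w, hw⟩ : U) =
        ∑ i ∈ (taylor μ f).support, ((taylor μ f).coeff i * μ ^ i) • ⟨(N ^ i) x, hNx i⟩ := by
      apply Subtype.ext
      rw [Submodule.coe_sum]
      exact hf'
    rw [hw']
    exact Submodule.sum_mem _ fun i _ => Submodule.smul_mem _ _ (hmem i)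
  let b := Basis.mk hli hspan
  have hb : ∀ j, (b j : E) = (N ^ (e - 1 - (j : ℕ))) x := fun j => by
    simp [b, v]
  clear_value b
  obtain rfl : e = finrank ℂ U := by rw [finrank_eq_card_basis b, Fintype.card_fin]
  refine ⟨b, (μ⁻¹ • T).restrict fun w hw => U.smul_mem _ (hTU w hw), fun w => ?_, ?_⟩
  · simp [smul_smul, hμ]
  · have hS : ∀ j, ((μ⁻¹ • T).restrict fun w hw => U.smul_mem _ (hTU w hw)) (b j) =
        b j + if h : 1 ≤ (j : ℕ) then b ⟨j - 1, by omega⟩ else 0 := by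
      intro j
      apply Subtype.ext
      have hj := j.2
      have e1 : (μ⁻¹ • T) (b j) = b j + N (b j) := by simp [hN]
      rw [LinearMap.coe_restrict_apply, e1, Submodule.coe_add]
      congr 1
      rw [hb, ← Module.End.mul_apply, ← pow_succ']
      split_ifs with h
      · rw [hb]
        congr 2
        simp only
        omega
      · rw [hz _ (by omega)]; rfl
    ext a j
    rw [LinearMap.toMatrix_apply, hS]
    simp only [jordanBlock, Matrix.of_apply]
    split_ifs with hj haj haj' haj'
    · subst haj
      simp only [map_add, Basis.repr_self, Finsupp.add_apply, Finsupp.single_eq_same]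
      rw [Finsupp.single_eq_of_ne, add_zero]
      intro h
      have := congrArg Fin.val h
      simp only at this
      omega
    · rw [map_add, Basis.repr_self, Basis.repr_self, Finsupp.add_apply,
        Finsupp.single_eq_of_ne haj, zero_add,
        show (⟨(j : ℕ) - 1, by omega⟩ : Fin (finrank ℂ U)) = a from Fin.ext (by simp only; omega),
        Finsupp.single_eq_same]
    · rw [map_add, Basis.repr_self, Basis.repr_self, Finsupp.add_apply,
        Finsupp.single_eq_of_ne haj, zero_add, Finsupp.single_eq_of_ne]
      intro h
      have := congrArg Fin.val h
      simp only at this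
      omega
    · simp [*]
    · omega
    · rw [add_zero, Basis.repr_self, Finsupp.single_eq_of_ne ‹_›]

/-- The Jordan normal form: an endomorphism all of whose eigenvalues have modulus one has a block
decomposition. -/
theorem nonempty_blockDecomposition {E : Type*} [AddCommGroup E] [Module ℂ E]
    [FiniteDimensional ℂ E] (T : E →ₗ[ℂ] E)
    (hT : ∀ μ : ℂ, Module.End.HasEigenvalue T μ → ‖μ‖ = 1) : Nonempty (BlockDecomposition T) := by
  obtain ⟨k, U, x, p, e, hint, hp, hU, hann⟩ := exists_isInternal_cyclic T
  have hblock : ∀ i, ∃ (μ : ℂ) (b : Basis (Fin (finrank ℂ (U i))) ℂ (U i)) (S : U i →ₗ[ℂ] U i),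
      ‖μ‖ = 1 ∧ (∀ v : U i, T v = μ • (S v : E)) ∧
        LinearMap.toMatrix b b S = jordanBlock (finrank ℂ (U i)) := by
    intro i
    rcases Nat.eq_zero_or_pos (e i) with he | he
    -- Exponent 0 gives a zero summand, for which any scalar of modulus one will do.
    · have hx0 : x i = 0 := by
        have := (hann i 1).mpr (by simp [he])
        simpa using this
      obtain ⟨b, S, h⟩ := exists_jordanBlock_of_cyclic (T := T) (μ := 1) (e := 0) one_ne_zero
        (by simp [hx0]) (by simp) (hU i)
      exact ⟨1, b, S, by simp, h⟩
    · obtain ⟨μ, hμ⟩ := IsAlgClosed.exists_root (p i) (hp i).degree_pos.ne'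
      have hassoc : Associated (X - C μ) (p i) :=
        (irreducible_X_sub_C μ).associated_of_dvd (hp i) (dvd_iff_isRoot.mpr hμ)
      have hann' : ∀ j, ((T - algebraMap ℂ (Module.End ℂ E) μ) ^ j) (x i) = 0 ↔ e i ≤ j := by
        intro j
        have h1 := hann i ((X - C μ) ^ j)
        rw [map_pow, map_sub, aeval_X, aeval_C] at h1
        rw [h1, ← (hassoc.pow_pow (n := e i)).dvd_iff_dvd_left,
          pow_dvd_pow_iff (X_sub_C_ne_zero μ) (irreducible_X_sub_C μ).not_isUnit]
      -- The last nonzero vector (T - μ)^(e-1) x of the chain is an eigenvector for μ.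
      have hμ1 : ‖μ‖ = 1 := by
        refine hT μ (Module.End.hasEigenvalue_of_hasEigenvector
          (x := ((T - algebraMap ℂ (Module.End ℂ E) μ) ^ (e i - 1)) (x i)) ⟨?_, ?_⟩)
        · rw [Module.End.mem_eigenspace_iff, ← sub_eq_zero]
          have h2 := (hann' (e i - 1 + 1)).mpr (by omega)
          rw [pow_succ', Module.End.mul_apply] at h2
          simpa [LinearMap.sub_apply, Module.algebraMap_end_apply] using h2
        · rw [Ne, hann']
          omega
      have hμ0 : μ ≠ 0 := by rintro rfl; simp at hμ1
      have hN : (μ⁻¹ • T - 1 : Module.End ℂ E) =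
          μ⁻¹ • (T - algebraMap ℂ (Module.End ℂ E) μ) := by
        rw [smul_sub, Algebra.algebraMap_eq_smul_one, smul_smul, inv_mul_cancel₀ hμ0, one_smul]
      have hpow : ∀ j, ((μ⁻¹ • T - 1 : Module.End ℂ E) ^ j) (x i) = 0 ↔ e i ≤ j := by
        intro j
        rw [hN, _root_.smul_pow, LinearMap.smul_apply, smul_eq_zero, hann']
        simp [hμ0]
      obtain ⟨b, S, h⟩ := exists_jordanBlock_of_cyclic (T := T) hμ0 ((hpow (e i)).mpr le_rfl)
        (fun j hj h => by have := (hpow j).mp h; omega) (hU i)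
      exact ⟨μ, b, S, hμ1, h⟩
  choose μ b S hμ hS hJ using hblock
  exact ⟨{
    k := k
    V := U
    basis := b
    scalar := μ
    op := S
    isInternal := hint
    scalar_norm := hμ
    map_eq := hS
    charpoly_eq := fun i => by
      rw [← LinearMap.charpoly_toMatrix (S i) (b i), hJ, jordanBlock_charpoly]
    id_or_jordan := fun i => Or.inr (hJ i) }⟩

end Jordan

/-! ### Limit kernels of the positive and negative powers. -/

section LimitKernel

open Module

lemma exists_eq_sum_of_isInternal {R ι E : Type*} [Ring R] [Fintype ι] [DecidableEq ι]
    [AddCommGroup E] [Module R E] {U : ι → Submodule R E} (h : DirectSum.IsInternal U) (v : E) :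
    ∃ u : ∀ i, U i, v = ∑ i, (u i : E) := by
  classical
  obtain ⟨x, rfl⟩ := h.2 v
  refine ⟨fun i => x i, ?_⟩
  rw [DirectSum.coeAddMonoidHom_eq_dfinsuppSum]
  exact DFinsupp.sum_eq_sum_fintype _ fun _ => rfl

lemma eq_zero_of_sum_eq_zero_of_isInternal {R ι E : Type*} [Ring R] [Fintype ι] [DecidableEq ι]
    [AddCommGroup E] [Module R E] {U : ι → Submodule R E} (h : DirectSum.IsInternal U)
    (u : ∀ i, U i) (hu : ∑ i, (u i : E) = 0) : u = 0 := by
  classical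
  have h1 : DirectSum.coeAddMonoidHom U (DFinsupp.equivFunOnFintype.symm u) = 0 := by
    rw [← hu, DirectSum.coeAddMonoidHom_eq_dfinsuppSum]
    exact DFinsupp.sum_eq_sum_fintype _ fun _ => rfl
  have h2 := h.1 (h1.trans (map_zero _).symm)
  funext i
  exact DFunLike.congr_fun h2 i

/-- `S` has limit kernel `W` if, along every sequence of exponents, suitable multiples of powers
of `S` subconverge to a nonzero operator with kernel `W`. -/
def HasLimitKernel {E : Type*} [NormedAddCommGroup E] [NormedSpace ℂ E] [FiniteDimensional ℂ E]
    (S : E →ₗ[ℂ] E) (W : Submodule ℂ E) : Prop :=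
  ∀ e : ℕ → ℕ, Tendsto e atTop atTop → ∃ φ : ℕ → ℕ, StrictMono φ ∧
    ∃ c : ℕ → ℂ, (∀ j, c j ≠ 0) ∧ ∃ A : E →L[ℂ] E, A ≠ 0 ∧ (∀ v, A v = 0 ↔ v ∈ W) ∧
      Tendsto (fun j => c j • LinearMap.toContinuousLinearMap (S ^ e (φ j))) atTop (𝓝 A)

lemma UnitaryDecomposition.first_lt_iff {E : Type*} [AddCommGroup E] [Module ℂ E]
    {T : E →ₗ[ℂ] E} (D : UnitaryDecomposition T) (j : Fin D.k) :
    D.first < j ↔ j ≠ D.first := by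
  rw [Fin.lt_def, Ne, Fin.ext_iff]
  simp only [UnitaryDecomposition.first]
  omega

lemma UnitaryDecomposition.lt_last_iff {E : Type*} [AddCommGroup E] [Module ℂ E]
    {T : E →ₗ[ℂ] E} (D : UnitaryDecomposition T) (j : Fin D.k) :
    j < D.last ↔ j ≠ D.last := by
  have := j.2
  rw [Fin.lt_def, Ne, Fin.ext_iff]
  simp only [UnitaryDecomposition.last]
  omega

variable {E : Type*} [NormedAddCommGroup E] [NormedSpace ℂ E] [FiniteDimensional ℂ E]
  {T : E →ₗ[ℂ] E}

/-- Covers the map and its inverse together: only a strict maximum of the radii s at j₀ is used, and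
the nilpotent parts N matter only through the kernels of their powers, which agree for a unipotent
map and its inverse. -/
theorem hasLimitKernel_of_blocks (D : UnitaryDecomposition T) (j₀ : Fin D.k) {S : E →ₗ[ℂ] E}
    {s : Fin D.k → ℝ} (hs₀ : ∀ j, 0 < s j) (hs : ∀ j, j ≠ j₀ → s j < s j₀)
    (B : ∀ j, BlockDecomposition (D.op j)) {ν : ∀ j, Fin (B j).k → ℂ} (hν : ∀ j i, ‖ν j i‖ = 1)
    {N : ∀ j i, Module.End ℂ ((B j).V i)}
    (hS : ∀ j i (u : (B j).V i), S ((u : D.V j) : E) =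
      ((s j : ℂ) * ν j i) • (((u + N j i u : (B j).V i) : D.V j) : E))
    (hN : ∀ j i d u, (N j i ^ d) u = 0 ↔ (((B j).op i - 1) ^ d) u = 0) :
    HasLimitKernel S (Submodule.span ℂ
      ((⋃ j : {j : Fin D.k // j ≠ j₀}, (D.V j : Set E)) ∪ Subtype.val '' (B j₀).Xi)) := by
  classical
  intro e he
  have : Nontrivial (D.V j₀) := Submodule.nontrivial_iff_ne_bot.mpr (D.V_ne_bot j₀)
  have hNpow : ∀ j i d, ((B j).op i - 1) ^ d = 0 → N j i ^ d = 0 := fun j i d h =>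
    LinearMap.ext fun u => (hN j i d u).mpr (by rw [h]; rfl)
  let f : ∀ j i, (B j).V i →ₗ[ℂ] E := fun j i => (D.V j).subtype ∘ₗ ((B j).V i).subtype
  have hθ : ∀ j i, ‖(s j : ℂ) * ν j i‖ = s j := fun j i => by
    rw [norm_mul, hν, mul_one, Complex.norm_real, Real.norm_of_nonneg (hs₀ j).le]
  have hfV : ∀ j (v : D.V j), ∃ u : ∀ i, (B j).V i, (v : E) = ∑ i, f j i (u i) := by
    intro j v
    obtain ⟨u, hu⟩ := exists_eq_sum_of_isInternal (B j).isInternal v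
    refine ⟨u, ?_⟩
    rw [hu, Submodule.coe_sum]
    rfl
  let W : Submodule ℂ E := ⨆ j : {j : Fin D.k // j ≠ j₀}, D.V j
  have hsurj : ∀ v, ∃ w ∈ W, ∃ u : ∀ i, (B j₀).V i, v = w + ∑ i, f j₀ i (u i) := by
    intro v
    obtain ⟨x, rfl⟩ := exists_eq_sum_of_isInternal D.isInternal v
    obtain ⟨u, hu⟩ := hfV j₀ (x j₀)
    refine ⟨∑ j ∈ Finset.univ.erase j₀, (x j : E), ?_, u, ?_⟩
    · refine Submodule.sum_mem _ fun j hj => ?_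
      exact Submodule.mem_iSup_of_mem ⟨j, Finset.ne_of_mem_erase hj⟩ (x j).2
    · rw [← hu, Finset.sum_erase_add _ _ (Finset.mem_univ j₀)]
  have hinj : ∀ u : ∀ i, (B j₀).V i, ∑ i, f j₀ i (u i) = 0 → u = 0 := by
    intro u hu
    refine eq_zero_of_sum_eq_zero_of_isInternal (B j₀).isInternal u (Subtype.ext ?_)
    rw [Submodule.coe_sum]
    exact hu
  -- Each V_j with j ≠ j₀ splits into blocks whose scalar has modulus s j < s j₀, so the normalised
  -- powers decay there.
  have hW : ∀ w ∈ W, Tendsto (fun m : ℕ => ((s j₀ : ℂ) ^ m)⁻¹ • (S ^ m) w) atTop (𝓝 0) := by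
    intro w hw
    induction hw using Submodule.iSup_induction' with
    | mem j v hv =>
      obtain ⟨u, hu⟩ := hfV j ⟨v, hv⟩
      have h1 := tendsto_finsetSum Finset.univ fun i _ =>
        tendsto_pow_apply_zero (f := f j i) (hS j i)
          ⟨_, hNpow j i _ ((B j).op_sub_one_pow_finrank i)⟩
          (by rw [hθ]; exact hs j j.2) (u i)
      rw [Finset.sum_const_zero] at h1
      refine h1.congr fun m => ?_
      rw [show v = _ from hu, map_sum, Finset.smul_sum]
    | zero => simp
    | add x y _ _ hx hy => simpa using hx.add hy
  obtain ⟨φ, hφ, c, hc, A, hA, hker⟩ := exists_subseq_tendsto_normalized_pow (f j₀) W hsurj hinj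
    (hs₀ j₀) (hθ j₀) (hS j₀) (fun i => hNpow j₀ i _ ((B j₀).op_sub_one_pow_H i)) hW he
  have hAW : ∀ w ∈ W, A w = 0 := fun w hw => by
    simpa using (hker w hw 0).mpr (by simp)
  have hAf : ∀ i u, (((B j₀).op i - 1) ^ ((B j₀).H - 1)) u = 0 → A (f j₀ i u) = 0 := by
    intro i u hu
    have h1 := (hker 0 W.zero_mem (Pi.single i u)).mpr fun i' => by
      rcases eq_or_ne i' i with rfl | h
      · rw [Pi.single_eq_same, hN, hu]
      · rw [Pi.single_eq_of_ne h, map_zero]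
    rw [Finset.sum_eq_single i (fun i' _ h => by rw [Pi.single_eq_of_ne h, map_zero]) (by simp),
      Pi.single_eq_same, zero_add] at h1
    exact h1
  refine ⟨φ, hφ, c, hc, A, ?_, fun v => ?_, hA⟩
  · rintro rfl
    obtain ⟨i, u, hu⟩ := (B j₀).exists_op_sub_one_pow_ne_zero
    have h1 := (hker 0 W.zero_mem (Pi.single i u)).mp (by simp) i
    rw [Pi.single_eq_same, hN] at h1
    exact hu h1
  · have hspan : Submodule.span ℂ (Subtype.val '' (B j₀).Xi) =
        (⨆ i, (LinearMap.ker (((B j₀).op i - 1) ^ ((B j₀).H - 1))).map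
          ((B j₀).V i).subtype).map (D.V j₀).subtype := by
      rw [← (B j₀).span_Xi, Submodule.map_span]
      rfl
    rw [Submodule.span_union, hspan, Submodule.span_iUnion]
    simp only [Submodule.span_eq]
    constructor
    · intro hv
      obtain ⟨w, hw, u, rfl⟩ := hsurj v
      refine Submodule.add_mem_sup hw (Submodule.sum_mem _ fun i _ => ?_)
      refine Submodule.mem_map_of_mem (Submodule.mem_iSup_of_mem i (Submodule.mem_map_of_mem ?_))
      exact (hN _ _ _ _).mp ((hker w hw u).mp hv i)
    · intro hv
      have hle : W ⊔ (⨆ i, (LinearMap.ker (((B j₀).op i - 1) ^ ((B j₀).H - 1))).map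
          ((B j₀).V i).subtype).map (D.V j₀).subtype ≤ LinearMap.ker (A : E →ₗ[ℂ] E) := by
        refine sup_le hAW (Submodule.map_le_iff_le_comap.mpr (iSup_le fun i => ?_))
        rintro _ ⟨u, hu, rfl⟩
        exact hAf i u hu
      exact hle hv

lemma UnitaryDecomposition.nonempty_blockDecomposition (D : UnitaryDecomposition T)
    (j : Fin D.k) : Nonempty (BlockDecomposition (D.op j)) :=
  ProjDyn.nonempty_blockDecomposition _ (D.eigenvalue_norm j)

/-- The limit kernel of the positive powers. -/
theorem hasLimitKernel_last (D : UnitaryDecomposition T) (B : BlockDecomposition (D.op D.last)) :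
    HasLimitKernel T (Submodule.span ℂ
      ((⋃ j : {j : Fin D.k // j < D.last}, (D.V j : Set E)) ∪ Subtype.val '' B.Xi)) := by
  -- The given decomposition is kept on the dominant summand; arbitrary ones suffice on the others,
  -- where only decay is needed.
  let Bs : ∀ j, BlockDecomposition (D.op j) :=
    Function.update (fun j => (D.nonempty_blockDecomposition j).some) D.last B
  have h := hasLimitKernel_of_blocks D D.last (S := T) D.r_pos
      (fun j hj => D.r_strictMono ((D.lt_last_iff j).mpr hj)) Bs
      (fun j i => (Bs j).scalar_norm i) (N := fun j i => (Bs j).op i - 1)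
      (fun j i u => by
        rw [D.map_eq, (Bs j).map_eq, Submodule.coe_smul, smul_smul]
        simp) (fun _ _ _ _ => Iff.rfl)
  have hset : (⋃ j : {j : Fin D.k // j < D.last}, (D.V j : Set E)) =
      ⋃ j : {j : Fin D.k // j ≠ D.last}, (D.V j : Set E) := by
    ext v
    simp [D.lt_last_iff]
  rw [hset]
  rwa [show Bs D.last = B from Function.update_self _ _ _] at h

lemma isUnit_of_isNilpotent_sub_one {R : Type*} [Ring R] {a : R} (h : IsNilpotent (a - 1)) :
    IsUnit a := by
  simpa using h.isUnit_add_one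

/-- a⁻¹ - 1 = -a⁻¹(a - 1) with commuting factors, so the two d-th powers differ by an invertible
map. -/
lemma inv_sub_one_pow_apply_eq_zero_iff {X : Type*} [AddCommGroup X] [Module ℂ X]
    (a : (Module.End ℂ X)ˣ) (d : ℕ) (u : X) :
    (((a⁻¹ : (Module.End ℂ X)ˣ) - 1 : Module.End ℂ X) ^ d) u = 0 ↔
      ((a - 1 : Module.End ℂ X) ^ d) u = 0 := by
  have h1 : ((a⁻¹ : (Module.End ℂ X)ˣ) - 1 : Module.End ℂ X) =
      (a⁻¹ : (Module.End ℂ X)ˣ) * -(a - 1 : Module.End ℂ X) := by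
    rw [neg_sub, mul_sub, mul_one, Units.inv_mul]
  have hc : Commute ((a⁻¹ : (Module.End ℂ X)ˣ) : Module.End ℂ X) (-(a - 1 : Module.End ℂ X)) :=
    ((Commute.refl (a : Module.End ℂ X)).units_inv_left.sub_right
      (Commute.one_right _)).neg_right
  rw [h1, hc.mul_pow, Module.End.mul_apply, ← Units.val_pow_eq_pow_val]
  have hinj : Function.Injective ((a⁻¹ ^ d : (Module.End ℂ X)ˣ) : Module.End ℂ X) :=
    ((Module.End.isUnit_iff _).mp (a⁻¹ ^ d).isUnit).1
  rw [map_eq_zero_iff _ hinj, neg_pow]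
  rcases Nat.even_or_odd d with h | h <;> simp [h.neg_one_pow]

/-- The limit kernel of the negative powers. -/
theorem hasLimitKernel_first (D : UnitaryDecomposition T) (B : BlockDecomposition (D.op D.first))
    {T' : E →ₗ[ℂ] E} (hT' : ∀ v, T' (T v) = v) :
    HasLimitKernel T' (Submodule.span ℂ
      ((⋃ j : {j : Fin D.k // D.first < j}, (D.V j : Set E)) ∪ Subtype.val '' B.Xi)) := by
  let Bs : ∀ j, BlockDecomposition (D.op j) :=
    Function.update (fun j => (D.nonempty_blockDecomposition j).some) D.first B
  have hunit : ∀ j i, IsUnit ((Bs j).op i) := fun j i => by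
    have h1 : IsNilpotent ((Bs j).op i - 1 : Module.End ℂ ((Bs j).V i)) :=
      ⟨_, (Bs j).op_sub_one_pow_finrank i⟩
    exact isUnit_of_isNilpotent_sub_one (R := Module.End ℂ ((Bs j).V i)) h1
  choose a ha using hunit
  have h := hasLimitKernel_of_blocks D D.first (S := T') (s := fun j => (D.r j)⁻¹)
      (fun j => inv_pos.mpr (D.r_pos j))
      (fun j hj => inv_strictAnti₀ (D.r_pos _) (D.r_strictMono ((D.first_lt_iff j).mpr hj))) Bs
      (ν := fun j i => ((Bs j).scalar i)⁻¹)
      (fun j i => by rw [norm_inv, (Bs j).scalar_norm, inv_one])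
      (N := fun j i => ((a j i)⁻¹ : (Module.End ℂ ((Bs j).V i))ˣ) - 1)
      (fun j i u => by
        have hr : (D.r j : ℂ) ≠ 0 := by exact_mod_cast (D.r_pos j).ne'
        have hl : (Bs j).scalar i ≠ 0 := fun h => by
          have := (Bs j).scalar_norm i
          simp [h] at this
        -- x is the preimage of u under the block operator, so T x = rλ u; applying T' gives T' u =
        -- (rλ)⁻¹ x.
        set x : (Bs j).V i := ((a j i)⁻¹ : (Module.End ℂ ((Bs j).V i))ˣ).1 u with hx
        have hax : (Bs j).op i x = u := by
          rw [hx, ← ha, ← Module.End.mul_apply, Units.mul_inv]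
          rfl
        have h1 : T ((x : D.V j) : E) =
            ((D.r j : ℂ) * (Bs j).scalar i) • ((u : D.V j) : E) := by
          rw [D.map_eq, (Bs j).map_eq, hax, Submodule.coe_smul, smul_smul]
        have h2 : u + (((a j i)⁻¹ : (Module.End ℂ ((Bs j).V i))ˣ).1 - 1) u = x := by
          rw [LinearMap.sub_apply, Module.End.one_apply, ← hx]
          abel
        have h3 := hT' ((x : D.V j) : E)
        rw [h1, map_smul] at h3
        rw [h2, ← h3, smul_smul]
        push_cast
        field_simp
        simp)
      (fun j i d u => by rw [← ha]; exact inv_sub_one_pow_apply_eq_zero_iff _ d u)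
  have hset : (⋃ j : {j : Fin D.k // D.first < j}, (D.V j : Set E)) =
      ⋃ j : {j : Fin D.k // j ≠ D.first}, (D.V j : Set E) := by
    ext v
    simp [D.first_lt_iff]
  rw [hset]
  rwa [show Bs D.first = B from Function.update_self _ _ _] at h

end LimitKernel

/-! ### From limit kernels to the equicontinuity region. -/

section Dynamics

variable {n : ℕ}

local notation "ℂⁿ" => Fin (n + 1) → ℂ
local notation "Mat" => Matrix (Fin (n + 1)) (Fin (n + 1)) ℂ
local notation "SLn" => Matrix.SpecialLinearGroup (Fin (n + 1)) ℂ

/-- A nonzero factor is invisible projectively, so normalising the powers does not change the maps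
of ℙⁿ. -/
lemma pow_smul_mk (h : SLn) (m : ℕ) {c : ℂ} (hc : c ≠ 0) (v : ℂⁿ) (hv : v ≠ 0) :
    ∃ h' : (c • LinearMap.toContinuousLinearMap (Matrix.toLin' (h : Mat) ^ m)) v ≠ 0,
      (QuotientGroup.mk h : PSL n) ^ m • (Projectivization.mk ℂ v hv : PSpace n) =
        Projectivization.mk ℂ
          ((c • LinearMap.toContinuousLinearMap (Matrix.toLin' (h : Mat) ^ m)) v) h' := by
  have h1 : (h ^ m) • v = (Matrix.toLin' (h : Mat) ^ m) v := by
    rw [← Matrix.toLin'_pow, Matrix.toLin'_apply, ← Matrix.SpecialLinearGroup.coe_pow]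
    rfl
  have h2 : (c • LinearMap.toContinuousLinearMap (Matrix.toLin' (h : Mat) ^ m)) v =
      c • ((h ^ m) • v) := by
    rw [h1]; rfl
  have h3 : (h ^ m) • v ≠ 0 := (smul_ne_zero_iff_ne _).mpr hv
  refine ⟨by rw [h2]; exact smul_ne_zero hc h3, ?_⟩
  rw [← QuotientGroup.mk_pow, Matrix.ProjectiveSpecialLinearGroup.smul_proj_mk,
    Projectivization.smul_mk, Projectivization.mk_eq_mk_iff']
  refine ⟨c⁻¹, ?_⟩
  rw [h2, smul_smul, inv_mul_cancel₀ hc, one_smul]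

lemma mk_mem_projectivize {W : Submodule ℂ ℂⁿ} (p : PSpace n) :
    p ∈ projectivize W ↔ p.rep ∈ W := by
  constructor
  · rintro ⟨v, hv, hvW, rfl⟩
    obtain ⟨a, ha⟩ := Projectivization.exists_smul_eq_mk_rep ℂ v hv
    rw [← ha]
    exact W.smul_mem _ hvW
  · intro h
    exact ⟨p.rep, p.rep_nonzero, h, p.mk_rep.symm⟩

/-- The limit kernel of the powers of an element of the group avoids the equicontinuity region. -/
theorem notMem_equicontinuityRegion {h : SLn}
    {W : Submodule ℂ ℂⁿ} (hW : HasLimitKernel (Matrix.toLin' (h : Mat)) W)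
    {Γ : Subgroup (PSL n)}
    (hΓ : (QuotientGroup.mk h : PSL n) ∈ Γ) {p : PSpace n} (hp : p.rep ∈ W) :
    p ∉ equicontinuityRegion (groupMaps Γ) := by
  rintro ⟨U, hU, hpU, hnorm⟩
  obtain ⟨φ, -, c, hc, A, hA, hker, hlim⟩ := hW id tendsto_id
  obtain ⟨φ', hφ', f₀, hf₀⟩ := hnorm
    (fun j p => (QuotientGroup.mk h : PSL n) ^ φ j • p) fun j => ⟨_, Γ.pow_mem hΓ _, rfl⟩
  exact not_uniform_limit_of_tendsto (hlim.comp hφ'.tendsto_atTop) hA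
    (fun m v hv => pow_smul_mk h _ (hc _) v hv) p.rep_nonzero ((hker _).mpr hp) hU
    (by rwa [Projectivization.mk_rep]) f₀ hf₀

/-- Away from its limit kernel, sequences of powers have uniformly convergent subsequences. -/
lemma exists_uniform_limit_pow {h : SLn}
    {W : Submodule ℂ ℂⁿ} (hW : HasLimitKernel (Matrix.toLin' (h : Mat)) W) {e : ℕ → ℕ}
    (he : Tendsto e atTop atTop) : ∃ φ : ℕ → ℕ, StrictMono φ ∧ ∃ f₀ : PSpace n → PSpace n,
      ∀ K : Set (PSpace n), IsCompact K → K ⊆ {p | p.rep ∉ W} →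
        ∀ ε : ℝ, 0 < ε → ∃ M : ℕ, ∀ m, M ≤ m → ∀ x ∈ K,
          fsDist ((QuotientGroup.mk h : PSL n) ^ e (φ m) • x) (f₀ x) < ε := by
  obtain ⟨φ, hφ, c, hc, A, -, hker, hlim⟩ := hW e he
  obtain ⟨f₀, hf₀⟩ := exists_uniform_limit_of_tendsto hlim
    (F := fun j p => (QuotientGroup.mk h : PSL n) ^ e (φ j) • p)
    fun m v hv => pow_smul_mk h _ (hc _) v hv
  exact ⟨φ, hφ, f₀, fun K hK hKW => hf₀ K hK fun p hp => fun h0 => hKW hp ((hker _).mp h0)⟩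

/-- A sequence of integers has a subsequence that is constant or tends to `±∞`. -/
lemma exists_subseq_int (z : ℕ → ℤ) : ∃ φ : ℕ → ℕ, StrictMono φ ∧
    ((∃ a, ∀ j, z (φ j) = a) ∨
      (∃ e : ℕ → ℕ, Tendsto e atTop atTop ∧ ∀ j, z (φ j) = e j) ∨
      ∃ e : ℕ → ℕ, Tendsto e atTop atTop ∧ ∀ j, z (φ j) = -e j) := by
  by_cases h1 : ∀ N : ℕ, ∃ᶠ k in atTop, (N : ℤ) ≤ z k
  · obtain ⟨φ, hφ, h⟩ := extraction_forall_of_frequently h1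
    refine ⟨φ, hφ, Or.inr (Or.inl ⟨fun j => (z (φ j)).toNat, ?_, fun j => ?_⟩)⟩
    · exact tendsto_atTop_mono (fun j => by have := h j; simp only [id_eq]; omega) tendsto_id
    · have := h j; simp only; omega
  by_cases h2 : ∀ N : ℕ, ∃ᶠ k in atTop, z k ≤ -(N : ℤ)
  · obtain ⟨φ, hφ, h⟩ := extraction_forall_of_frequently h2
    refine ⟨φ, hφ, Or.inr (Or.inr ⟨fun j => (-z (φ j)).toNat, ?_, fun j => ?_⟩)⟩
    · exact tendsto_atTop_mono (fun j => by have := h j; simp only [id_eq]; omega) tendsto_id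
    · have := h j; simp only; omega
  push Not at h1 h2
  obtain ⟨N₁, h1⟩ := h1
  obtain ⟨N₂, h2⟩ := h2
  -- The remaining sequences are eventually bounded, so one of finitely many values recurs
  -- infinitely often.
  have h3 : ∃ a, ∃ᶠ k in atTop, z k = a := by
    by_contra! h
    have h4 : ∀ᶠ k in atTop, ∀ a ∈ Finset.Icc (-(N₂ : ℤ)) N₁, z k ≠ a :=
      (Finset.eventually_all _).mpr fun a _ => h a
    obtain ⟨k, ⟨hk1, hk2⟩, hk⟩ := ((h1.and h2).and h4).exists
    exact hk (z k) (Finset.mem_Icc.mpr ⟨by omega, by omega⟩) rfl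
  obtain ⟨a, ha⟩ := h3
  obtain ⟨φ, hφ, h⟩ := extraction_of_frequently_atTop ha
  exact ⟨φ, hφ, Or.inl ⟨a, h⟩⟩

/-- The complement of both limit kernels is one open set on which the family is normal: W governs
exponents tending to +∞, W' those tending to -∞, and constant exponents are trivial. -/
theorem mem_equicontinuityRegion {g : SLn}
    {W W' : Submodule ℂ ℂⁿ} (hW : HasLimitKernel (Matrix.toLin' (g : Mat)) W)
    (hW' : HasLimitKernel (Matrix.toLin' ((g⁻¹ : SLn) : Mat)) W') {p : PSpace n} (hp : p.rep ∉ W)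
    (hp' : p.rep ∉ W') :
    p ∈ equicontinuityRegion (groupMaps (Subgroup.zpowers (QuotientGroup.mk g : PSL n))) := by
  refine ⟨{p | p.rep ∈ ((W : Set ℂⁿ) ∪ W')ᶜ}, isOpen_setOf_rep ?_ ?_, ?_, ?_⟩
  · exact (W.closed_of_finiteDimensional.union W'.closed_of_finiteDimensional).isOpen_compl
  · intro c hc v hv h
    exact hv (h.imp (fun h => (W.smul_mem_iff hc).mp h) fun h => (W'.smul_mem_iff hc).mp h)
  · exact fun h => h.elim hp hp'
  · intro f hf
    choose h hh hfh using hf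
    choose z hz using fun m => Subgroup.mem_zpowers_iff.mp (hh m)
    obtain ⟨φ, hφ, ⟨a, ha⟩ | ⟨e, he, hze⟩ | ⟨e, he, hze⟩⟩ := exists_subseq_int z
    · refine ⟨φ, hφ, fun p => (QuotientGroup.mk g : PSL n) ^ a • p, fun K _ _ ε hε =>
        ⟨0, fun m _ x _ => ?_⟩⟩
      rw [hfh, ← hz, ha, fsDist_self]
      exact hε
    · obtain ⟨φ', hφ', f₀, hf₀⟩ := exists_uniform_limit_pow hW he
      refine ⟨φ ∘ φ', hφ.comp hφ', f₀, fun K hK hKU ε hε => ?_⟩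
      obtain ⟨M, hM⟩ := hf₀ K hK (fun p hp h => hKU hp (Or.inl h)) ε hε
      refine ⟨M, fun m hm x hx => ?_⟩
      rw [Function.comp_apply, hfh, ← hz, hze, zpow_natCast]
      exact hM m hm x hx
    · obtain ⟨φ', hφ', f₀, hf₀⟩ := exists_uniform_limit_pow hW' he
      refine ⟨φ ∘ φ', hφ.comp hφ', f₀, fun K hK hKU ε hε => ?_⟩
      obtain ⟨M, hM⟩ := hf₀ K hK (fun p hp h => hKU hp (Or.inr h)) ε hε
      refine ⟨M, fun m hm x hx => ?_⟩
      rw [Function.comp_apply, hfh, ← hz, hze, zpow_neg, zpow_natCast, ← inv_pow,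
        ← QuotientGroup.mk_inv]
      exact hM m hm x hx

end Dynamics

end ProjDyn

end

open ProjDyn in
theorem theoremt (n : ℕ) (γ : PSL n) (hγ : ¬ IsOfFinOrder γ)
    (g : Matrix.SpecialLinearGroup (Fin (n + 1)) ℂ) (hg : (QuotientGroup.mk g : PSL n) = γ)
    (D : UnitaryDecomposition (Matrix.toLin' (g : Matrix (Fin (n + 1)) (Fin (n + 1)) ℂ))) :
    Nonempty (BlockDecomposition (D.op D.first)) ∧
    Nonempty (BlockDecomposition (D.op D.last)) ∧
    ∀ (B₁ : BlockDecomposition (D.op D.first)) (Bk : BlockDecomposition (D.op D.last)),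
      (equicontinuityRegion (groupMaps (Subgroup.zpowers γ)))ᶜ =
        projectivize (Submodule.span ℂ
          ((⋃ j : {j : Fin D.k // D.first < j}, (D.V j : Set (Fin (n + 1) → ℂ))) ∪
            Subtype.val '' B₁.Xi)) ∪
        projectivize (Submodule.span ℂ
          ((⋃ j : {j : Fin D.k // j < D.last}, (D.V j : Set (Fin (n + 1) → ℂ))) ∪
            Subtype.val '' Bk.Xi)) := by
  refine ⟨D.nonempty_blockDecomposition _, D.nonempty_blockDecomposition _, fun B₁ Bk => ?_⟩
  subst hg
  have hinv : ∀ v, Matrix.toLin' ((g⁻¹ : Matrix.SpecialLinearGroup (Fin (n + 1)) ℂ) :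
      Matrix (Fin (n + 1)) (Fin (n + 1)) ℂ)
      (Matrix.toLin' (g : Matrix (Fin (n + 1)) (Fin (n + 1)) ℂ) v) = v := fun v => by
    rw [← LinearMap.comp_apply, ← Matrix.toLin'_mul, ← Matrix.SpecialLinearGroup.coe_mul,
      inv_mul_cancel, Matrix.SpecialLinearGroup.coe_one, Matrix.toLin'_one, LinearMap.id_apply]
  have h₁ := hasLimitKernel_first D B₁ hinv
  have hk := hasLimitKernel_last D Bk
  ext p
  rw [Set.mem_compl_iff, Set.mem_union, mk_mem_projectivize, mk_mem_projectivize]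
  constructor
  · intro hp
    by_contra! hc
    exact hp (mem_equicontinuityRegion hk h₁ hc.2 hc.1)
  · rintro (hp | hp)
    · exact notMem_equicontinuityRegion h₁
        (inv_mem (Subgroup.mem_zpowers (QuotientGroup.mk g : PSL n))) hp
    · exact notMem_equicontinuityRegion hk (Subgroup.mem_zpowers _) hp
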